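/- **Definitions.** An $n$-dimensional (Newton) diagram is a function $D:\mathbb Z^n\to\{0,P,N\}$ recording the signs of the coefficients of a real polynomial $q=(p-1)/(x_1+\cdots+x_n-1)$, where $p$ is a real polynomial for which this quotient is a polynomial ($D(\alpha)=P$, $N$, $0$ if the coefficient of $x^\alpha$ is positive, negative, zero or absent). Write $|\alpha|=\alpha_1+\cdots+\alpha_n$, and let $\mathrm{down}_k(\alpha)$ be $\alpha$ with $\alpha_k$ replaced by $\alpha_k-1$. If $\{x\in\mathbb Z^n : x_j\ge a_j \text{ for all } j,\ |x|\le t\}$ is the smallest set of this form containing all nonzero points of $D$, then the size of $D$ is $t-|a|+1$. A point $\alpha$ is a sink if $D(\alpha)\in\{N,0\}$, all $D(\mathrm{down}_k\alpha)\in\{P,0\}$, and not all these values are $0$; a source is defined likewise with $P$ and $N$ interchanged. Sinks and sources are called nodes, and $\#(D)$ is the number of nodes. *Views.* For $k\ne m$ in $\{1,\dots,n\}$, the view $V(D,k,m)$ is the $(n-1)$-dimensional diagram obtained by merging the $k$th and $m$th coordinates into one, in the place of the $k$th (the $m$th is deleted): its value at a point with merged entry $c$ is the value of $D$ at the point with $k$th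 entry $a$, $m$th entry $c-a$ and the same other entries, for the smallest integer $a$ for which this value is nonzero (and $0$ if there is no such $a$). *Faces.* Let $\nu(\alpha)$ be the number of $k$ with $D(\mathrm{down}_k\alpha)\ne0$. If $D(\alpha)=0$, then $\alpha$ is a top-corner, on a horizontal edge, or in the interior of a horizontal face when $\nu(\alpha)=1,2,3$ respectively. If $D(\alpha)\neq0$, then $\alpha$ is a bottom-corner, on a vertical edge, or in the interior of a vertical face when $\nu(\alpha)=0,1,2$ respectively. A node in the interior of a vertical or horizontal face is a facial node. A vertical face of a two-dimensional diagram is a maximal nonempty connected set of points that are corners, on edges or in the interior of a vertical face, neighbours being points that differ by $\pm1$ in exactly one coordinate. A horizontal face of $D$ is a maximal nonempty connected set of points that are corners, on horizontal edges or in the interior of a horizontal face, inside a plane given by fixing $|\alpha|$ and all coordinates but three, neighbours being points $\alpha,\beta$ with $\alpha-\beta=e_i-e_j$, $i\ne j$, where $e_1,\dots,e_n$ are the standard unit vectors. It is a top horizontal face if its degree $|\alpha|$ is the highest among horizontal faces. *Complete sets.* Let $D$ have its lowest nonzero point at the origin, and let $k\ne m$. A complete set of simple diagrams corresponding to the edge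 $(x_k,x_m)$ is a list $(F_1,\dots,F_s)$ of two-dimensional diagrams produced as follows, starting with $r=0$. Choose a point $\alpha$ with $D(\alpha)\ne 0$ and $|\alpha|=r$ whose degree $\sum_{i\ne k,m}\alpha_i$ in the other variables is smallest among such points. Restrict $D$ to the plane through $\alpha$ in which only the $k$th and $m$th coordinates vary, take the vertical face of this two-dimensional diagram that contains $\alpha$, and let $F$ be its part consisting of points of degree at least $r$ in $D$. Add $F$ to the list, replace $r$ by $r$ plus the number of nonzero rows of $F$ (a row consists of the points of one degree), and repeat, until no nonzero points of $D$ of degree at least $r$ remain. **Lemma.** Let $n\ge4$ and let $D$ be an $n$-dimensional diagram of size $d$ with a unique source, at the origin. Then there exist $k\neq m$ in $\{1,\dots,n\}$ such that $$\#\bigl(V(D,k,m)\bigr)\le \#(D)-d .$$ Furthermore, if some complete set of simple diagrams corresponding to some edge contains a facial node (that is, one of its members $F_j$ has a facial node as a two-dimensional diagram), or if some top horizontal face contains more than three nodes of $D$, then there exist $k\ne m$ in $\{1,\dots,n\}$ such that $$\#\bigl(V(D,k,m)\bigr)< \#(D)-d .$$ -/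

import Mathlib

/-- An `n`-dimensional array of `P`s, `N`s and `0`s, indexed by `ℤⁿ`.
The letters are `P = 1`, `N = -1` and `0 = 0` in `SignType`. -/
abbrev Diagram (n : ℕ) : Type := (Fin n → ℤ) → SignType

namespace Diagram

/-- The degree `|α| = α₁ + ⋯ + αₙ`. -/
def degree {n : ℕ} (α : Fin n → ℤ) : ℤ := ∑ i, α i

/-- The Newton diagram of a polynomial `q`: the signs of its coefficients, extended by `0` to the
multi-indices with a negative entry. -/
noncomputable def ofPoly {n : ℕ} (q : MvPolynomial (Fin n) ℝ) : Diagram n := fun α =>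
  if ∀ i, 0 ≤ α i then
    SignType.sign (q.coeff (Finsupp.equivFunOnFinite.symm fun i => (α i).toNat))
  else 0

/-- `D` is the Newton diagram corresponding to some polynomial `p`, that is, the diagram of the
polynomial `q` with `p - 1 = (s - 1) q`, where `s = x₁ + ⋯ + xₙ`. -/
def IsNewton {n : ℕ} (D : Diagram n) : Prop :=
  ∃ p q : MvPolynomial (Fin n) ℝ, p - 1 = ((∑ i, MvPolynomial.X i) - 1) * q ∧ D = ofPoly q

/-- The set of points where `D` is nonzero. -/
def supp {n : ℕ} (D : Diagram n) : Set (Fin n → ℤ) := {α | D α ≠ 0}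

/-- The simplex `{x : x_j ≥ a_j for all j, |x| ≤ k}`. -/
def box {n : ℕ} (a : Fin n → ℤ) (k : ℕ) : Set (Fin n → ℤ) :=
  {x | (∀ j, a j ≤ x j) ∧ degree x ≤ k}

/-- `D` has size `d`: the smallest simplex `box a k` containing the support of `D` has
`k - |a| + 1 = d`. -/
def HasSize {n : ℕ} (D : Diagram n) (d : ℕ) : Prop :=
  ∃ (a : Fin n → ℤ) (k : ℕ),
    IsLeast {K : Set (Fin n → ℤ) | (∃ (a' : Fin n → ℤ) (k' : ℕ), K = box a' k') ∧ D.supp ⊆ K}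
      (box a k) ∧
    (d : ℤ) = k - degree a + 1

/-- Subtract `1` from the `k`th entry. -/
def down {n : ℕ} (k : Fin n) (α : Fin n → ℤ) : Fin n → ℤ := Function.update α k (α k - 1)

def IsSink {n : ℕ} (D : Diagram n) (α : Fin n → ℤ) : Prop :=
  (D α = -1 ∨ D α = 0) ∧ (∀ k, D (down k α) = 1 ∨ D (down k α) = 0) ∧
    (D α ≠ 0 ∨ ∃ k, D (down k α) ≠ 0)

def IsSource {n : ℕ} (D : Diagram n) (α : Fin n → ℤ) : Prop :=
  (D α = 1 ∨ D α = 0) ∧ (∀ k, D (down k α) = -1 ∨ D (down k α) = 0) ∧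
    (D α ≠ 0 ∨ ∃ k, D (down k α) ≠ 0)

def IsNode {n : ℕ} (D : Diagram n) (α : Fin n → ℤ) : Prop := IsSink D α ∨ IsSource D α

def nodes {n : ℕ} (D : Diagram n) : Set (Fin n → ℤ) := {α | IsNode D α}

/-- The number `#(D)` of nodes. -/
noncomputable def numNodes {n : ℕ} (D : Diagram n) : ℕ := D.nodes.ncard

/-! ### Corners, edges and faces -/

/-- The number of directions `k` with `D (down k α) ≠ 0`. -/
def numDown {n : ℕ} (D : Diagram n) (α : Fin n → ℤ) : ℕ :=
  (Finset.univ.filter fun k => D (down k α) ≠ 0).card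

def IsTopCorner {n : ℕ} (D : Diagram n) (α : Fin n → ℤ) : Prop := D α = 0 ∧ numDown D α = 1

def IsBottomCorner {n : ℕ} (D : Diagram n) (α : Fin n → ℤ) : Prop := D α ≠ 0 ∧ numDown D α = 0

def OnHorizontalEdge {n : ℕ} (D : Diagram n) (α : Fin n → ℤ) : Prop := D α = 0 ∧ numDown D α = 2

def OnVerticalEdge {n : ℕ} (D : Diagram n) (α : Fin n → ℤ) : Prop := D α ≠ 0 ∧ numDown D α = 1

/-- `α` lies in the interior of a vertical face. -/
def InVerticalFace {n : ℕ} (D : Diagram n) (α : Fin n → ℤ) : Prop := D α ≠ 0 ∧ numDown D α = 2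

/-- `α` lies in the interior of a horizontal face. -/
def InHorizontalFace {n : ℕ} (D : Diagram n) (α : Fin n → ℤ) : Prop := D α = 0 ∧ numDown D α = 3

def IsFacialNode {n : ℕ} (D : Diagram n) (α : Fin n → ℤ) : Prop :=
  IsNode D α ∧ (InVerticalFace D α ∨ InHorizontalFace D α)

/-- `S` is connected: any two of its elements are joined by a path of `adj`-neighbours in `S`. -/
def Conn {n : ℕ} (adj : (Fin n → ℤ) → (Fin n → ℤ) → Prop) (S : Set (Fin n → ℤ)) : Prop :=
  ∀ α ∈ S, ∀ β ∈ S, Relation.ReflTransGen (fun x y => x ∈ S ∧ y ∈ S ∧ adj x y) α β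

/-- Neighbours in the lattice: one entry differs, by `±1`. -/
def Adj {n : ℕ} (α β : Fin n → ℤ) : Prop := ∃ k, β = down k α ∨ α = down k β

/-- Neighbours inside a set of constant degree: one entry is larger by `1` and another smaller
by `1`, that is, lowering one entry of each gives the same point. -/
def HAdj {n : ℕ} (α β : Fin n → ℤ) : Prop := ∃ i j, i ≠ j ∧ down i α = down j β

/-- `S` is a vertical face of the two-dimensional diagram `E`: a maximal connected set of points
that are corners, lie on edges, or lie in a vertical face. -/
def IsVerticalFace (E : Diagram 2) (S : Set (Fin 2 → ℤ)) : Prop :=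
  S.Nonempty ∧
  Maximal (fun S' : Set (Fin 2 → ℤ) =>
    (∀ α ∈ S', IsTopCorner E α ∨ IsBottomCorner E α ∨ OnHorizontalEdge E α ∨ OnVerticalEdge E α ∨
      InVerticalFace E α) ∧ Conn Adj S') S

/-- `S` is a horizontal face of `D` in degree `t`: a maximal connected set of points that are
corners, lie on a horizontal edge, or lie in a horizontal face, inside a two-dimensional plane
given by `|α| = t` and by fixing all coordinates but three. -/
def IsHorizontalFace {n : ℕ} (D : Diagram n) (t : ℤ) (S : Set (Fin n → ℤ)) : Prop :=
  S.Nonempty ∧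
  ∃ (i j l : Fin n) (c : Fin n → ℤ), i ≠ j ∧ i ≠ l ∧ j ≠ l ∧
    Maximal (fun S' : Set (Fin n → ℤ) =>
      (∀ α ∈ S', (IsTopCorner D α ∨ IsBottomCorner D α ∨ OnHorizontalEdge D α ∨
          InHorizontalFace D α) ∧
        degree α = t ∧ ∀ h, h ≠ i → h ≠ j → h ≠ l → α h = c h) ∧ Conn HAdj S') S

/-- A horizontal face in the highest degree in which there are horizontal faces. -/
def IsTopHorizontalFace {n : ℕ} (D : Diagram n) (S : Set (Fin n → ℤ)) : Prop :=
  ∃ t, IsHorizontalFace D t S ∧ ∀ t' S', IsHorizontalFace D t' S' → t' ≤ t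

/-! ### Complete sets of simple diagrams -/

/-- The point that agrees with `α` except that its `k`th and `m`th coordinates are `v 0`, `v 1`. -/
def planePoint {n : ℕ} (k m : Fin n) (α : Fin n → ℤ) (v : Fin 2 → ℤ) : Fin n → ℤ :=
  Function.update (Function.update α k (v 0)) m (v 1)

/-- The two-dimensional diagram cut out of `D` by the plane through `α` in which only the `k`th and
`m`th coordinates vary. -/
def planeDiagram {n : ℕ} (D : Diagram n) (k m : Fin n) (α : Fin n → ℤ) : Diagram 2 :=
  fun v => D (planePoint k m α v)

/-- The degree of `α` in the variables other than the `k`th and the `m`th. -/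
def otherDegree {n : ℕ} (k m : Fin n) (α : Fin n → ℤ) : ℤ :=
  ∑ i ∈ Finset.univ.filter (fun i => i ≠ k ∧ i ≠ m), α i

/-- The number of nonzero rows of a two-dimensional diagram. -/
noncomputable def height (F : Diagram 2) : ℕ := (degree '' F.supp).ncard

open Classical in
/-- The part of the face `S` of the plane diagram through `α` consisting of the points whose degree
in `D` is at least `r`. -/
noncomputable def facePart {n : ℕ} (D : Diagram n) (k m : Fin n) (α : Fin n → ℤ)
    (S : Set (Fin 2 → ℤ)) (r : ℤ) : Diagram 2 := fun v =>
  if v ∈ S ∧ r ≤ degree (planePoint k m α v) then planeDiagram D k m α v else 0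

/-- `𝓕` results from the following procedure started in degree `r`.  If `D` has no nonzero point
of degree at least `r`, stop.  Otherwise choose a nonzero point `α` of degree `r` with the smallest
possible degree in the variables other than the `k`th and the `m`th, let `F` be the part in degrees
`≥ r` of the face containing `α` in the plane through `α`, and continue in the degree directly
above the top row of `F`. -/
inductive IsCompleteFrom {n : ℕ} (D : Diagram n) (k m : Fin n) : ℤ → List (Diagram 2) → Prop
  | nil (r : ℤ) (h : ∀ α, D α ≠ 0 → degree α < r) : IsCompleteFrom D k m r []
  | cons (r : ℤ) (α : Fin n → ℤ) (S : Set (Fin 2 → ℤ)) (𝓕 : List (Diagram 2))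
      (hα : D α ≠ 0) (hr : degree α = r)
      (hmin : ∀ β, D β ≠ 0 → degree β = r → otherDegree k m α ≤ otherDegree k m β)
      (hS : IsVerticalFace (planeDiagram D k m α) S) (hαS : ![α k, α m] ∈ S)
      (h𝓕 : IsCompleteFrom D k m (r + height (facePart D k m α S r)) 𝓕) :
      IsCompleteFrom D k m r (facePart D k m α S r :: 𝓕)

/-- `𝓕 = (F₁, …, F_s)` is a complete set of simple diagrams corresponding to the edge `(x_k, x_m)`
of a diagram `D` whose bottom point is the origin. -/
def IsCompleteSet {n : ℕ} (D : Diagram n) (k m : Fin n) (𝓕 : List (Diagram 2)) : Prop :=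
  IsCompleteFrom D k m 0 𝓕

/-! ### Views -/

/-- Insert `b` into `α` as the new `m`th entry, and let the `k`th entry of the result be `a`. -/
def gamma {n : ℕ} (k m : Fin (n + 1)) (α : Fin n → ℤ) (a b : ℤ) : Fin (n + 1) → ℤ :=
  Function.update (Fin.insertNth (α := fun _ => ℤ) m b α) k a

/-- The entry of `α` that `gamma k m α a b` replaces by `a` (for `k < m`, it is the `k`th one). -/
def mergedEntry {n : ℕ} (k m : Fin (n + 1)) (α : Fin n → ℤ) : ℤ :=
  Fin.insertNth (α := fun _ => ℤ) m 0 α k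

open Classical in
/-- The view `V(D, k, m)`: its value at `α` is the value of `D` at the point `gamma k m α a b` with
`a + b` equal to the merged entry and with the smallest `a` for which this value is nonzero; it is
`0` if there is no such `a`. -/
noncomputable def view {n : ℕ} (D : Diagram (n + 1)) (k m : Fin (n + 1)) : Diagram n := fun α =>
  if h : ∃ a, IsLeast {a : ℤ | D (gamma k m α a (mergedEntry k m α - a)) ≠ 0} a then
    D (gamma k m α h.choose (mergedEntry k m α - h.choose))
  else 0

end Diagram

/-!
Merging the `k`th and `m`th coordinate projects `D` onto the view `V(D, k, m)`.  The fibres are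
lines in direction `e_k - e_m`, and each node of the view lifts to a node of `D` of the same type,
namely to the first *active* point of its fibre, where `D` or one of the points below is nonzero
(`OnlySourceZero.exists_isLift`).  So `#(D) - #(V(D, k, m))` is the number of nodes of `D` that are
not such lifts, and one has to find many of these.  There are two sources of them.

* A node `σ` with `D(σ - e_k) ≠ 0` is not a lift, because `σ - e_k + e_m` is active and comes
  earlier in the fibre (`not_isLift_of_down`).
* Let a plane in the directions `k`, `m` have, from some degree on, the smallest possible degree in
  the other variables.  There only the two directions of the plane matter, and every nonzero row
  begins and ends with a `P`, since extremal `N`s would propagate upwards forever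
  (`OnlySourceZero.not_all_neg`).  Over a nonzero row the view therefore has a `P` and no node, and
  all nodes in that row are spare; over the first zero row at most one node is a lift.

For two consecutive rows, the sinks in the upper one, with those having `P`s in both directions
below and an `N` on top counted twice, are bounded below by `1 + Φ(lower) - Φ(upper)`, where the
weight `Φ` (`rowWeight`) is the number of nonzero entries minus twice the number of runs of `N`s,
zeros next to a run of `N`s being counted as part of it. Scanning the two rows from left to right,
this is a statement about a finite automaton (`scan_step`). As `Φ ≥ 1` for nonzero rows and `Φ = 0`
for zero rows, the bounds telescope, also when one moves to another plane at the top of the current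
one, and give at least as many spare nodes as there are degrees, up to the number `f(k, m)` of
facial nodes on the edge (`OnlySourceZero.exists_spare`).

Nodes with nonzero points below them exactly in the directions `k` and `i ≠ m` are never lifts for
`(k, m)` and differ from all the nodes above. Write `a(k, i)` for their number, so that `f(k, m) ≤
a(k, m)`. The loss is at least `d - a(k, m) + ∑ a(k, i)`, the sum running over `i ≠ k, m`. Choosing
`m` with `a(k, m)` minimal, the sum has at least two terms `≥ a(k, m)` when there are at least four
variables, so the loss is at least `d`, and more if some `a(k, i)` is positive
(`OnlySourceZero.exists_lt_of_pairNodes`). If all of them vanish, any node with a nonzero point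
below it in a direction `k` that is missing from the count for some edge `(k, m)` makes the
inequality strict (`OnlySourceZero.exists_lt_of_lower`). A facial node of a complete set is such a
node, and so is one of any four nodes in a top horizontal face
(`OnlySourceZero.exists_lt_of_topFace`).
-/

namespace Diagram

/-! ### Sign sequences and consecutive rows -/

/-- The last nonzero value of `f` at a position `≤ x`, and `0` if there is none. -/
def prevSign (f : ℕ → SignType) : ℕ → SignType
  | 0 => f 0
  | x + 1 => if f (x + 1) = 0 then prevSign f x else f (x + 1)

open Classical in
/-- The first nonzero value of `f` at a position `> x`, and `0` if there is none. -/
noncomputable def nextSign (f : ℕ → SignType) (x : ℕ) : SignType :=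
  if h : ∃ y, x < y ∧ f y ≠ 0 then f (Nat.find h) else 0

/-- The contribution of one position to the weight of a row.  Here `v` is the value at this
position, `p` the last nonzero value up to it and `q` the next one after it.  Every nonzero entry
counts `1`, and so does every `0` that is separated from some `N` by zeros only; each maximal run
of `N`s (with those zeros) costs `2`, charged to the `P` in front of it. -/
def cellWeight (v p q : SignType) : ℤ :=
  (if v ≠ 0 ∨ p = -1 ∨ q = -1 then 1 else 0) - (if v = 1 ∧ q = -1 then 2 else 0)

/-- The weight of a row of signs in the positions `1, …, L`. -/
noncomputable def rowWeight (f : ℕ → SignType) (L : ℕ) : ℤ :=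
  ∑ x ∈ Finset.range L, cellWeight (f (x + 1)) (prevSign f (x + 1)) (nextSign f (x + 1))

/-- A point with value `g`, above points with values `u` and `v` and otherwise zeros, is not a
source. -/
def NotSource (u v g : SignType) : Prop :=
  g = -1 ∨ u = 1 ∨ v = 1 ∨ (g = 0 ∧ u = 0 ∧ v = 0)

instance (u v g : SignType) : Decidable (NotSource u v g) := by unfold NotSource; infer_instance

/-- The number of sinks, facial ones counted twice, contributed by a point with value `g` above
points with values `u` and `v`. -/
def sinkWeight (u v g : SignType) : ℤ :=
  if g ≠ 1 ∧ u ≠ -1 ∧ v ≠ -1 ∧ (g ≠ 0 ∨ u ≠ 0 ∨ v ≠ 0) then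
    if g ≠ 0 ∧ u ≠ 0 ∧ v ≠ 0 then 2 else 1
  else 0

/-- A row of signs in the positions `1, …, L - 1` whose first and last nonzero entries are `P`. -/
structure IsRow (f : ℕ → SignType) (L : ℕ) : Prop where
  zero : f 0 = 0
  bound : ∀ x, L ≤ x → f x = 0
  left : ∀ x, f x = -1 → ∃ y, y < x ∧ f y ≠ 0
  right : ∀ x, f x = -1 → ∃ y, x < y ∧ f y ≠ 0

theorem prevSign_succ (f : ℕ → SignType) (x : ℕ) :
    prevSign f (x + 1) = if f (x + 1) = 0 then prevSign f x else f (x + 1) := rfl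

theorem nextSign_eq (f : ℕ → SignType) (x : ℕ) :
    nextSign f x = if f (x + 1) = 0 then nextSign f (x + 1) else f (x + 1) := by
  classical
  by_cases h0 : f (x + 1) = 0
  · rw [if_pos h0]
    have hiff : ∀ y, (x < y ∧ f y ≠ 0) ↔ (x + 1 < y ∧ f y ≠ 0) := by
      intro y
      constructor
      · rintro ⟨h1, h2⟩
        refine ⟨?_, h2⟩
        rcases Nat.lt_or_ge (x + 1) y with h | h
        · exact h
        · have : y = x + 1 := by omega
          exact absurd (this ▸ h0) h2
      · rintro ⟨h1, h2⟩
        exact ⟨by omega, h2⟩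
    unfold nextSign
    simp only [hiff]
  · rw [if_neg h0]
    have h : ∃ y, x < y ∧ f y ≠ 0 := ⟨x + 1, by omega, h0⟩
    unfold nextSign
    rw [dif_pos h]
    have : Nat.find h = x + 1 := by
      rw [Nat.find_eq_iff]
      exact ⟨⟨by omega, h0⟩, fun m hm hc => by omega⟩
    rw [this]

theorem nextSign_eq_zero {f : ℕ → SignType} {x : ℕ} (h : ∀ y, x < y → f y = 0) :
    nextSign f x = 0 := by
  unfold nextSign
  rw [dif_neg]
  rintro ⟨y, h1, h2⟩
  exact h2 (h y h1)

theorem exists_first_of_nextSign_ne_zero {f : ℕ → SignType} {x : ℕ} (h : nextSign f x ≠ 0) :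
    ∃ y, x < y ∧ f y = nextSign f x ∧ ∀ z, x < z → z < y → f z = 0 := by
  classical
  unfold nextSign at h ⊢
  split_ifs at h ⊢ with h1
  · refine ⟨Nat.find h1, (Nat.find_spec h1).1, rfl, fun z hz hzy => ?_⟩
    by_contra hc
    exact Nat.find_min h1 hzy ⟨hz, hc⟩
  · exact absurd rfl h

theorem exists_last_of_prevSign_ne_zero {f : ℕ → SignType} {x : ℕ} (h : prevSign f x ≠ 0) :
    ∃ y, y ≤ x ∧ f y = prevSign f x ∧ ∀ z, y < z → z ≤ x → f z = 0 := by
  induction x with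
  | zero => exact ⟨0, le_rfl, rfl, fun z h1 h2 => by omega⟩
  | succ x ih =>
    rw [prevSign_succ] at h ⊢
    split_ifs at h ⊢ with h0
    · obtain ⟨y, h1, h2, h3⟩ := ih h
      refine ⟨y, by omega, h2, fun z hz hzx => ?_⟩
      rcases Nat.lt_or_ge x z with h4 | h4
      · rw [show z = x + 1 by omega, h0]
      · exact h3 z hz h4
    · exact ⟨x + 1, le_rfl, rfl, fun z h1 h2 => by omega⟩

theorem prevSign_ne_zero {f : ℕ → SignType} {x y : ℕ} (hyx : y ≤ x) (hy : f y ≠ 0) :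
    prevSign f x ≠ 0 := by
  induction x with
  | zero => rw [show y = 0 by omega] at hy; exact hy
  | succ x ih =>
    rw [prevSign_succ]
    split_ifs with h0
    · refine ih ?_
      rcases Nat.lt_or_ge x y with h | h
      · rw [show y = x + 1 by omega] at hy; exact absurd h0 hy
      · exact h
    · exact h0

theorem IsRow.nextSign_zero {f : ℕ → SignType} {L : ℕ} (hf : IsRow f L) : nextSign f 0 ≠ -1 := by
  intro h
  obtain ⟨y, h1, h2, h3⟩ := exists_first_of_nextSign_ne_zero (f := f) (x := 0) (by rw [h]; decide)
  obtain ⟨z, hz, hz0⟩ := hf.left y (h2.trans h)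
  rcases Nat.eq_zero_or_pos z with h4 | h4
  · exact hz0 (h4 ▸ hf.zero)
  · exact hz0 (h3 z h4 hz)

theorem IsRow.prevSign_last {f : ℕ → SignType} {L : ℕ} (hf : IsRow f L) : prevSign f L ≠ -1 := by
  intro h
  obtain ⟨y, h1, h2, h3⟩ := exists_last_of_prevSign_ne_zero (f := f) (x := L) (by rw [h]; decide)
  obtain ⟨z, hz, hz0⟩ := hf.right y (h2.trans h)
  rcases Nat.lt_or_ge L z with h4 | h4
  · exact hz0 (hf.bound z h4.le)
  · exact hz0 (h3 z hz h4)

/-- Above zeros that precede an `N` there can only be zeros and `N`s, and just above that `N` there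
is an `N`. -/
theorem nextSign_eq_neg_of_lower {f g : ℕ → SignType}
    (hns : ∀ x, NotSource (f x) (f (x + 1)) (g (x + 1))) {x : ℕ} (h0 : f x = 0)
    (h : nextSign f x = -1) : nextSign g x = -1 := by
  obtain ⟨y, h1, h2, h3⟩ := exists_first_of_nextSign_ne_zero (f := f) (x := x) (by rw [h]; decide)
  rw [h] at h2
  obtain ⟨k, rfl⟩ : ∃ k, y = x + 1 + k := ⟨y - (x + 1), by omega⟩
  clear h h1
  induction k generalizing x with
  | zero =>
    have := hns x
    rw [h0, h2] at this
    rw [nextSign_eq]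
    have hg : g (x + 1) = -1 := by
      rcases this with h | h | h | h
      · exact h
      · exact absurd h (by decide)
      · exact absurd h (by decide)
      · exact absurd h.2.2 (by decide)
    rw [hg, if_neg (by decide)]
  | succ k ih =>
    have hx1 : f (x + 1) = 0 := h3 _ (by omega) (by omega)
    have := hns x
    rw [h0, hx1] at this
    have hrec := ih (x := x + 1) hx1 (by rw [← h2]; congr 1; omega)
      (fun z hz hz' => h3 z (by omega) (by omega))
    rw [nextSign_eq]
    rcases this with h | h | h | h
    · rw [h, if_neg (by decide)]
    · exact absurd h (by decide)
    · exact absurd h (by decide)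
    · rw [if_pos h.1, hrec]

/-- The constraints satisfied by the values `v` of the lower row, the last nonzero values `p`, `p'`
and the next nonzero values `q`, `q'` of the lower and the upper row, at a given position. -/
def ScanInv (v p q p' q' : SignType) : Prop :=
  (v ≠ 0 → p = v) ∧ (p = 0 → p' = 0 ∧ q ≠ -1) ∧ (p' = 0 → q' ≠ -1) ∧
    (v = 0 → p = -1 → p' = -1) ∧ (v = 0 → q = -1 → q' = -1)

instance (v p q p' q' : SignType) : Decidable (ScanInv v p q p' q') := by
  unfold ScanInv; infer_instance

/-- A lower bound for the sinks counted up to a position, plus the weight of the upper row minus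
the weight of the lower row up to there, in terms of the surroundings of this position. -/
def scanBound (v p q p' q' : SignType) : ℤ :=
  if v = 1 then (if q = -1 then 2 else 0) - (if p' = 1 ∧ q' = -1 then 2 else 0)
  else if v = -1 then (if p' = -1 ∨ p' = 1 ∧ q' = -1 then 0 else 1)
  else if p = 1 then
    (if q = -1 then 1 else 0) + (if p' = -1 then 0 else if q' = -1 then -1 else 1)
  else 0

/-- The sign `v`, or `q` if `v = 0`: the rule by which `prevSign` and `nextSign` move on by one
position (`prevSign_succ`, `nextSign_eq`). -/
def firstSign (v q : SignType) : SignType := if v = 0 then q else v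

/-- Moving on by one position, from values `v₀`, `p₀`, `p₀'` on the left to values `v`, `g` and
the following signs `q`, `q'`, preserves the constraints and the lower bound. -/
theorem scan_step : ∀ v₀ p₀ p₀' v q g q' : SignType,
    ScanInv v₀ p₀ (firstSign v q) p₀' (firstSign g q') →
    NotSource v₀ v g → (v = 0 → q = -1 → q' = -1) →
    ScanInv v (firstSign v p₀) q (firstSign g p₀') q' ∧
      scanBound v (firstSign v p₀) q (firstSign g p₀') q' ≤
        scanBound v₀ p₀ (firstSign v q) p₀' (firstSign g q') + sinkWeight v₀ v g +
          cellWeight g (firstSign g p₀') q' - cellWeight v (firstSign v p₀) q := by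
  decide +kernel

/-- The sinks in a row, facial ones counted twice, in terms of the weights of this row and of the
nonzero row below it. -/
theorem one_add_rowWeight_sub_le {f g : ℕ → SignType} {L : ℕ} (hf : IsRow f L)
    (hg : IsRow g (L + 1)) (hne : ∃ x, f x ≠ 0)
    (hns : ∀ x, NotSource (f x) (f (x + 1)) (g (x + 1))) :
    1 + rowWeight f (L + 1) - rowWeight g (L + 1) ≤
      ∑ x ∈ Finset.range (L + 1), sinkWeight (f x) (f (x + 1)) (g (x + 1)) := by
  have key : ∀ x, ScanInv (f x) (prevSign f x) (nextSign f x) (prevSign g x) (nextSign g x) ∧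
      scanBound (f x) (prevSign f x) (nextSign f x) (prevSign g x) (nextSign g x) ≤
        (∑ y ∈ Finset.range x, sinkWeight (f y) (f (y + 1)) (g (y + 1))) +
          rowWeight g x - rowWeight f x := by
    intro x
    induction x with
    | zero =>
      have hf0 := hf.nextSign_zero
      have hg0 := hg.nextSign_zero
      have e1 : prevSign f 0 = 0 := hf.zero
      have e2 : prevSign g 0 = 0 := hg.zero
      rw [e1, e2, hf.zero]
      simp only [Finset.range_zero, Finset.sum_empty, rowWeight]
      revert hf0 hg0
      generalize nextSign f 0 = a
      generalize nextSign g 0 = b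
      revert a b
      decide
    | succ x ih =>
      obtain ⟨i1, i2⟩ := ih
      have s := scan_step (f x) (prevSign f x) (prevSign g x) (f (x + 1)) (nextSign f (x + 1))
        (g (x + 1)) (nextSign g (x + 1))
      rw [nextSign_eq f x, nextSign_eq g x] at i1 i2
      obtain ⟨j1, j2⟩ := s i1 (hns x) (fun h h' => nextSign_eq_neg_of_lower hns h h')
      refine ⟨j1, ?_⟩
      have e1 : rowWeight f (x + 1) = rowWeight f x + cellWeight (f (x + 1)) (prevSign f (x + 1))
          (nextSign f (x + 1)) := Finset.sum_range_succ _ _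
      have e2 : rowWeight g (x + 1) = rowWeight g x + cellWeight (g (x + 1)) (prevSign g (x + 1))
          (nextSign g (x + 1)) := Finset.sum_range_succ _ _
      rw [Finset.sum_range_succ, e1, e2]
      refine j2.trans ?_
      change _ ≤ (_ + sinkWeight (f x) (f (x + 1)) (g (x + 1))) + (_ + cellWeight (g (x + 1))
        (firstSign (g (x + 1)) (prevSign g x)) (nextSign g (x + 1))) - (_ + cellWeight (f (x + 1))
        (firstSign (f (x + 1)) (prevSign f x)) (nextSign f (x + 1)))
      have i2' : scanBound (f x) (prevSign f x) (firstSign (f (x + 1)) (nextSign f (x + 1)))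
        (prevSign g x) (firstSign (g (x + 1)) (nextSign g (x + 1))) ≤ _ := i2
      linarith
  obtain ⟨-, h⟩ := key (L + 1)
  obtain ⟨x, hx⟩ := hne
  have hxL : x ≤ L := by
    by_contra hc
    exact hx (hf.bound x (by omega))
  have p1 : prevSign f (L + 1) = prevSign f L := by
    rw [prevSign_succ, if_pos (hf.bound _ (by omega))]
  have p2 := hf.prevSign_last
  have p3 := prevSign_ne_zero hxL hx
  have p4 : prevSign f (L + 1) = 1 := by
    rw [p1]
    revert p2 p3
    generalize prevSign f L = a
    revert a
    decide
  have p5 := hg.prevSign_last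
  rw [p4, hf.bound (L + 1) (by omega), nextSign_eq_zero (fun y hy => hf.bound y (by omega)),
    nextSign_eq_zero (fun y hy => hg.bound y (by omega))] at h
  have : scanBound 0 1 0 (prevSign g (L + 1)) 0 = 1 := by
    revert p5
    generalize prevSign g (L + 1) = a
    revert a
    decide
  rw [this] at h
  linarith

/-- A lower bound for the weight of a row up to a position, in terms of the surroundings of this
position. -/
def prefixBound (v p q : SignType) : ℤ :=
  if v = 1 then (if q = -1 then -1 else 1)
  else if v = -1 then 0
  else if p = 0 then 0 else if p = 1 ∧ q = -1 then 0 else 1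

theorem prefix_step : ∀ v₀ p₀ v q : SignType,
    ((v₀ ≠ 0 → p₀ = v₀) ∧ (p₀ = 0 → firstSign v q ≠ -1)) →
    ((v ≠ 0 → firstSign v p₀ = v) ∧ (firstSign v p₀ = 0 → q ≠ -1)) ∧
      prefixBound v (firstSign v p₀) q ≤
        prefixBound v₀ p₀ (firstSign v q) + cellWeight v (firstSign v p₀) q := by
  decide

theorem one_le_rowWeight {f : ℕ → SignType} {L : ℕ} (hf : IsRow f L) (hne : ∃ x, f x ≠ 0) :
    1 ≤ rowWeight f L := by
  have key : ∀ x, ((f x ≠ 0 → prevSign f x = f x) ∧ (prevSign f x = 0 → nextSign f x ≠ -1)) ∧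
      prefixBound (f x) (prevSign f x) (nextSign f x) ≤ rowWeight f x := by
    intro x
    induction x with
    | zero =>
      have hf0 := hf.nextSign_zero
      have e1 : prevSign f 0 = 0 := hf.zero
      rw [e1, hf.zero]
      simp only [Finset.range_zero, Finset.sum_empty, rowWeight]
      revert hf0
      generalize nextSign f 0 = a
      revert a
      decide
    | succ x ih =>
      obtain ⟨i1, i2⟩ := ih
      rw [nextSign_eq f x] at i1 i2
      obtain ⟨j1, j2⟩ := prefix_step (f x) (prevSign f x) (f (x + 1)) (nextSign f (x + 1)) i1
      refine ⟨j1, ?_⟩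
      have e1 : rowWeight f (x + 1) = rowWeight f x + cellWeight (f (x + 1)) (prevSign f (x + 1))
          (nextSign f (x + 1)) := Finset.sum_range_succ _ _
      rw [e1]
      exact j2.trans (by simpa [prevSign_succ, firstSign] using i2)
  obtain ⟨-, h⟩ := key L
  obtain ⟨x, hx⟩ := hne
  have hxL : x ≤ L := by
    by_contra hc
    exact hx (hf.bound x (by omega))
  have p2 := hf.prevSign_last
  have p3 := prevSign_ne_zero hxL hx
  have p4 : prevSign f L = 1 := by
    revert p2 p3
    generalize prevSign f L = a
    revert a
    decide
  rw [p4, hf.bound L le_rfl, nextSign_eq_zero (fun y hy => hf.bound y (by omega))] at h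
  exact h

theorem rowWeight_succ_of_bound {f : ℕ → SignType} {L : ℕ} (hf : IsRow f L) :
    rowWeight f (L + 1) = rowWeight f L := by
  have e1 : rowWeight f (L + 1) = rowWeight f L + cellWeight (f (L + 1)) (prevSign f (L + 1))
      (nextSign f (L + 1)) := Finset.sum_range_succ _ _
  have p1 : prevSign f (L + 1) = prevSign f L := by
    rw [prevSign_succ, if_pos (hf.bound _ (by omega))]
  have p2 := hf.prevSign_last
  rw [e1, p1, hf.bound (L + 1) (by omega), nextSign_eq_zero (fun y hy => hf.bound y (by omega))]
  have : cellWeight 0 (prevSign f L) 0 = 0 := by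
    revert p2
    generalize prevSign f L = a
    revert a
    decide
  omega

theorem rowWeight_of_zero {f : ℕ → SignType} (hf : ∀ x, f x = 0) (L : ℕ) : rowWeight f L = 0 := by
  refine Finset.sum_eq_zero fun x _ => ?_
  have h1 : prevSign f (x + 1) = 0 := by
    by_contra h
    obtain ⟨y, -, h2, -⟩ := exists_last_of_prevSign_ne_zero h
    exact h (h2 ▸ hf y)
  rw [hf, h1, nextSign_eq_zero fun y _ => hf y]
  decide

/-! ### Diagrams whose only source is the origin -/

/-- `D` has finite support in the nonnegative orthant, and its only source is the origin. -/
structure OnlySourceZero {n : ℕ} (D : Diagram n) : Prop where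
  finite : D.supp.Finite
  nonneg : ∀ α, D α ≠ 0 → ∀ i, 0 ≤ α i
  source : ∀ α, IsSource D α ↔ α = 0

/-- `D` is nonzero at `α` or at one of the points below it. -/
def Active {n : ℕ} (D : Diagram n) (α : Fin n → ℤ) : Prop := D α ≠ 0 ∨ ∃ i, D (down i α) ≠ 0

/-- Add `1` to the `k`th entry. -/
def up {n : ℕ} (k : Fin n) (α : Fin n → ℤ) : Fin n → ℤ := Function.update α k (α k + 1)

variable {n : ℕ} {D : Diagram n}

@[simp] theorem down_self (k : Fin n) (α : Fin n → ℤ) : down k α k = α k - 1 := by simp [down]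

theorem down_of_ne {k i : Fin n} (h : i ≠ k) (α : Fin n → ℤ) : down k α i = α i := by
  simp [down, h]

@[simp] theorem up_self (k : Fin n) (α : Fin n → ℤ) : up k α k = α k + 1 := by simp [up]

theorem up_of_ne {k i : Fin n} (h : i ≠ k) (α : Fin n → ℤ) : up k α i = α i := by
  simp [up, h]

@[simp] theorem down_up (k : Fin n) (α : Fin n → ℤ) : down k (up k α) = α := by
  simp [down, up]

@[simp] theorem up_down (k : Fin n) (α : Fin n → ℤ) : up k (down k α) = α := by
  simp [down, up]

theorem degree_update (α : Fin n → ℤ) (k : Fin n) (v : ℤ) :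
    degree (Function.update α k v) = degree α - α k + v := by
  unfold degree
  rw [Finset.sum_update_of_mem (Finset.mem_univ k), ← Finset.add_sum_erase _ α (Finset.mem_univ k),
    Finset.sdiff_singleton_eq_erase]
  ring

@[simp] theorem degree_down (k : Fin n) (α : Fin n → ℤ) : degree (down k α) = degree α - 1 := by
  rw [down, degree_update]; ring

@[simp] theorem degree_up (k : Fin n) (α : Fin n → ℤ) : degree (up k α) = degree α + 1 := by
  rw [up, degree_update]; ring

theorem otherDegree_eq {k m : Fin n} (hkm : k ≠ m) (α : Fin n → ℤ) :
    otherDegree k m α = degree α - α k - α m := by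
  unfold otherDegree degree
  have h : Finset.univ.filter (fun i => i ≠ k ∧ i ≠ m) = (Finset.univ.erase k).erase m := by
    ext i; simp [and_comm]
  rw [h, ← Finset.add_sum_erase _ α (Finset.mem_univ k),
    ← Finset.add_sum_erase (Finset.univ.erase k) α
      (show m ∈ Finset.univ.erase k by simp [hkm.symm])]
  ring

theorem otherDegree_down_of_ne {k m j : Fin n} (hkm : k ≠ m) (hk : j ≠ k) (hm : j ≠ m)
    (α : Fin n → ℤ) : otherDegree k m (down j α) = otherDegree k m α - 1 := by
  rw [otherDegree_eq hkm, otherDegree_eq hkm, degree_down, down_of_ne hk.symm, down_of_ne hm.symm]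
  ring

theorem otherDegree_down_le {k m : Fin n} (hkm : k ≠ m) (j : Fin n) (α : Fin n → ℤ) :
    otherDegree k m (down j α) ≤ otherDegree k m α := by
  by_cases hk : j = k
  · subst hk
    rw [otherDegree_eq hkm, otherDegree_eq hkm, degree_down, down_self, down_of_ne hkm.symm]
    omega
  by_cases hm : j = m
  · subst hm
    rw [otherDegree_eq hkm, otherDegree_eq hkm, degree_down, down_self, down_of_ne hkm]
    omega
  · rw [otherDegree_down_of_ne hkm hk hm]; omega

theorem otherDegree_up_left {k m : Fin n} (hkm : k ≠ m) (α : Fin n → ℤ) :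
    otherDegree k m (up k α) = otherDegree k m α := by
  rw [otherDegree_eq hkm, otherDegree_eq hkm, degree_up, up_self, up_of_ne hkm.symm]
  ring

theorem sign_cases (a : SignType) : a = 0 ∨ a = -1 ∨ a = 1 := by revert a; decide

theorem degree_zero : degree (0 : Fin n → ℤ) = 0 := by simp [degree]

theorem ne_zero_of_degree_pos {α : Fin n → ℤ} (h : 0 < degree α) : α ≠ 0 := by
  rintro rfl
  rw [degree_zero] at h
  exact lt_irrefl _ h

theorem le_degree_of_nonneg {α : Fin n → ℤ} (h : ∀ i, 0 ≤ α i) (k : Fin n) : α k ≤ degree α :=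
  Finset.single_le_sum (fun i _ => h i) (Finset.mem_univ k)

theorem Active.nonneg (hD : D.OnlySourceZero) {α : Fin n → ℤ} (h : Active D α) (i : Fin n) :
    0 ≤ α i := by
  rcases h with h | ⟨j, h⟩
  · exact hD.nonneg α h i
  · have h1 := hD.nonneg _ h i
    by_cases hij : i = j
    · subst hij; rw [down_self] at h1; omega
    · rwa [down_of_ne hij] at h1

theorem OnlySourceZero.finite_active (hD : D.OnlySourceZero) : {α | Active D α}.Finite := by
  refine (hD.finite.union (Set.finite_iUnion fun i : Fin n => hD.finite.image (up i))).subset ?_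
  rintro α (h | ⟨i, h⟩)
  · exact Or.inl h
  · exact Or.inr (Set.mem_iUnion.2 ⟨i, down i α, h, up_down i α⟩)

theorem IsNode.active {α : Fin n → ℤ} (h : IsNode D α) : Active D α := by
  rcases h with h | h <;> exact h.2.2

theorem OnlySourceZero.finite_nodes (hD : D.OnlySourceZero) : D.nodes.Finite :=
  hD.finite_active.subset fun _ h => h.active

/-- An active point other than the origin that is not an `N` is not a source, so one of the points
below it is a `P`. -/
theorem OnlySourceZero.exists_down_eq_one (hD : D.OnlySourceZero) {α : Fin n → ℤ} (hα : α ≠ 0)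
    (h1 : D α ≠ -1) (h2 : Active D α) : ∃ i, D (down i α) = 1 := by
  by_contra! hc
  refine hα ((hD.source α).1 ⟨?_, fun k => ?_, h2⟩)
  · rcases sign_cases (D α) with h | h | h
    · exact Or.inr h
    · exact absurd h h1
    · exact Or.inl h
  · rcases sign_cases (D (down k α)) with h | h | h
    · exact Or.inr h
    · exact Or.inl h
    · exact absurd h (hc k)

/-- A set of lattice points that is closed under passing to nonzero points below (in degrees above
`u`) and under increasing one coordinate cannot have `N`s but no `P`s in degree `u`: the `N`s would
continue in all higher degrees. -/
theorem OnlySourceZero.not_all_neg (hD : D.OnlySourceZero) (U : Set (Fin n → ℤ)) {u : ℤ}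
    (hu : 0 ≤ u)
    (hdown : ∀ x ∈ U, u < degree x → ∀ j, D (down j x) ≠ 0 → down j x ∈ U)
    (k : Fin n) (hup : ∀ x ∈ U, up k x ∈ U) (hneg : ∀ x ∈ U, degree x = u → D x ≠ 1)
    {y : Fin n → ℤ} (hyU : y ∈ U) (hyu : degree y = u) (hy : D y = -1) : False := by
  have key : ∀ s : ℕ, (∀ x ∈ U, degree x = u + s → D x ≠ 1) ∧
      ∃ x ∈ U, degree x = u + s ∧ D x = -1 := by
    intro s
    induction s with
    | zero => exact ⟨by simpa using hneg, y, hyU, by simpa using hyu, hy⟩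
    | succ s ih =>
      obtain ⟨h1, x, hxU, hxs, hx⟩ := ih
      have hstep : ∀ z ∈ U, degree z = u + (s + 1 : ℕ) → Active D z → D z = -1 := by
        intro z hz hzs hza
        by_contra hc
        push_cast at hzs
        obtain ⟨i, hi⟩ := hD.exists_down_eq_one
          (ne_zero_of_degree_pos (by rw [hzs]; omega)) hc hza
        refine h1 _ (hdown z hz (by omega) i (by rw [hi]; decide)) ?_ hi
        rw [degree_down]; omega
      refine ⟨fun z hz hzs hz1 => ?_, up k x, hup x hxU, ?_, ?_⟩
      · have := hstep z hz hzs (Or.inl (by rw [hz1]; decide))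
        rw [hz1] at this
        exact absurd this (by decide)
      · rw [degree_up, hxs]; push_cast; ring
      · refine hstep _ (hup x hxU) (by rw [degree_up, hxs]; push_cast; ring)
          (Or.inr ⟨k, ?_⟩)
        rw [down_up, hx]; decide
  obtain ⟨T, hT⟩ := (hD.finite.image degree).bddAbove
  obtain ⟨-, x, -, hx, hxn⟩ := key (T - u + 1).toNat
  have h1 := hT ⟨x, (show D x ≠ 0 by rw [hxn]; decide), rfl⟩
  have h2 : T - u + 1 ≤ ((T - u + 1).toNat : ℤ) := Int.self_le_toNat _
  omega

/-- `T` is the highest degree of a nonzero point of `D`. -/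
structure IsTopDegree (D : Diagram n) (T : ℕ) : Prop where
  exists_eq : ∃ α, D α ≠ 0 ∧ degree α = T
  le : ∀ α, D α ≠ 0 → degree α ≤ T

theorem OnlySourceZero.degree_nonneg (hD : D.OnlySourceZero) {α : Fin n → ℤ} (h : D α ≠ 0) :
    0 ≤ degree α := Finset.sum_nonneg fun i _ => hD.nonneg α h i

theorem OnlySourceZero.apply_zero (hD : D.OnlySourceZero) : D 0 = 1 := by
  obtain ⟨h1, -, h2⟩ := (hD.source 0).2 rfl
  rcases h1 with h1 | h1
  · exact h1
  · rcases h2 with h2 | ⟨k, h2⟩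
    · exact absurd h1 h2
    · have := hD.nonneg _ h2 k
      simp at this

theorem OnlySourceZero.exists_isTopDegree (hD : D.OnlySourceZero) : ∃ T, D.IsTopDegree T := by
  have hne : (D.supp).Nonempty := ⟨0, show D 0 ≠ 0 by rw [hD.apply_zero]; decide⟩
  obtain ⟨α, hα, h⟩ := Set.exists_max_image D.supp degree hD.finite hne
  have h0 : ((degree α).toNat : ℤ) = degree α := Int.toNat_of_nonneg (hD.degree_nonneg hα)
  exact ⟨(degree α).toNat, ⟨α, hα, h0.symm⟩, fun β hβ => h0.symm ▸ h β hβ⟩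

/-- Every degree up to the top one contains a nonzero point. -/
theorem OnlySourceZero.exists_degree_eq (hD : D.OnlySourceZero) {T : ℕ} (hT : D.IsTopDegree T)
    {t : ℕ} (ht : t ≤ T) : ∃ α, D α ≠ 0 ∧ degree α = t := by
  induction ht using Nat.decreasingInduction with
  | self => exact hT.exists_eq
  | of_succ t _ ih =>
    obtain ⟨α, h0, hα⟩ := ih
    obtain ⟨β, hβ1, hβ⟩ : ∃ β, D β = 1 ∧ degree β = (t + 1 : ℕ) := by
      by_contra! hc
      have hneg : D α = -1 := by
        rcases sign_cases (D α) with h | h | h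
        · exact absurd h h0
        · exact h
        · exact absurd hα (hc α h)
      have hk : Nonempty (Fin n) := by
        by_contra hk
        rw [not_nonempty_iff] at hk
        have : degree α = 0 := by simp [degree]
        rw [this] at hα
        push_cast at hα
        omega
      obtain ⟨k⟩ := hk
      exact hD.not_all_neg Set.univ (u := (t + 1 : ℕ)) (by omega) (by simp) k (by simp)
        (fun x _ hx h => hc x h hx) (Set.mem_univ α) hα hneg
    obtain ⟨i, hi⟩ := hD.exists_down_eq_one (α := β)
      (ne_zero_of_degree_pos (by rw [hβ]; push_cast; omega)) (by rw [hβ1]; decide)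
      (Or.inl (by rw [hβ1]; decide))
    refine ⟨down i β, by rw [hi]; decide, ?_⟩
    rw [degree_down, hβ]; push_cast; ring

/-- `α` is a nonzero point of degree `t`, and no nonzero point of degree `≥ t` has a smaller degree
in the variables other than the `k`th and the `m`th. -/
structure IsLowest (D : Diagram n) (k m : Fin n) (t : ℕ) (α : Fin n → ℤ) : Prop where
  ne_zero : D α ≠ 0
  degree_eq : degree α = t
  le : ∀ β, D β ≠ 0 → (t : ℤ) ≤ degree β → otherDegree k m α ≤ otherDegree k m β

/-- The smallest degree in the other variables among the points of degree `t` does not decrease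
with `t`: a lower value would first be attained at `N`s only, contradicting
`OnlySourceZero.not_all_neg`. -/
theorem OnlySourceZero.isLowest (hD : D.OnlySourceZero) {k m : Fin n} (hkm : k ≠ m) {t : ℕ}
    {α : Fin n → ℤ} (h0 : D α ≠ 0) (hα : degree α = t)
    (hmin : ∀ β, D β ≠ 0 → degree β = t → otherDegree k m α ≤ otherDegree k m β) :
    D.IsLowest k m t α := by
  refine ⟨h0, hα, fun β hβ hβt => ?_⟩
  have key : ∀ s : ℕ, ∀ γ, D γ ≠ 0 → degree γ = t + s →
      otherDegree k m α ≤ otherDegree k m γ := by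
    intro s
    induction s using Nat.strong_induction_on with
    | _ s ih =>
      intro γ hγ hγs
      by_contra! hlt
      rcases Nat.eq_zero_or_pos s with rfl | hs
      · exact absurd (hmin γ hγ (by simpa using hγs)) (not_le.2 hlt)
      -- a `P` this low would have a nonzero point below it that is lower than `α`
      have hprev : ∀ x, otherDegree k m x ≤ otherDegree k m γ → degree x = t + s → D x ≠ 1 := by
        intro x hx hxs hx1
        obtain ⟨i, hi⟩ := hD.exists_down_eq_one (α := x)
          (ne_zero_of_degree_pos (by rw [hxs]; omega)) (by rw [hx1]; decide)
          (Or.inl (by rw [hx1]; decide))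
        have h1 := ih (s - 1) (by omega) (down i x) (by rw [hi]; decide)
          (by rw [degree_down, hxs]; omega)
        have h2 := otherDegree_down_le hkm i x
        omega
      have hneg : D γ = -1 := by
        rcases sign_cases (D γ) with h | h | h
        · exact absurd h hγ
        · exact h
        · exact absurd h (hprev γ le_rfl hγs)
      exact hD.not_all_neg {x | otherDegree k m x ≤ otherDegree k m γ} (u := t + s) (by omega)
        (fun x hx _ j _ => (otherDegree_down_le hkm j x).trans hx) k
        (fun x hx => (otherDegree_up_left hkm x).trans_le hx) hprev (le_refl (otherDegree k m γ)) hγs hneg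
  exact key (degree β - t).toNat β hβ (by omega)

theorem OnlySourceZero.exists_isLowest (hD : D.OnlySourceZero) {k m : Fin n} (hkm : k ≠ m)
    {t : ℕ} (h : ∃ α, D α ≠ 0 ∧ degree α = t) : ∃ α, D.IsLowest k m t α := by
  have hfin : ({α | D α ≠ 0 ∧ degree α = t} : Set (Fin n → ℤ)).Finite :=
    hD.finite.subset fun α h => h.1
  obtain ⟨α, hα, hmin⟩ := Set.exists_min_image _ (otherDegree k m) hfin h
  exact ⟨α, hD.isLowest hkm hα.1 hα.2 fun β h1 h2 => hmin β ⟨h1, h2⟩⟩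

/-! ### Rows of a plane -/

/-- The point of degree `t` in the plane through `α` in which the `k`th and `m`th coordinates vary,
with `k`th coordinate `x`. -/
def rowPoint (k m : Fin n) (α : Fin n → ℤ) (t x : ℤ) : Fin n → ℤ :=
  planePoint k m α ![x, t - otherDegree k m α - x]

/-- The row of degree `t` in the plane through `α`.  Positions are shifted by one, so that position
`0` stands for the `k`th coordinate `-1`. -/
def rowSigns (D : Diagram n) (k m : Fin n) (α : Fin n → ℤ) (t : ℕ) : ℕ → SignType :=
  fun x => D (rowPoint k m α t ((x : ℤ) - 1))

section Row

variable {k m : Fin n} {α : Fin n → ℤ}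

theorem rowPoint_left (hkm : k ≠ m) (t x : ℤ) : rowPoint k m α t x k = x := by
  simp [rowPoint, planePoint, hkm]

theorem rowPoint_right (t x : ℤ) : rowPoint k m α t x m = t - otherDegree k m α - x := by
  simp [rowPoint, planePoint]

theorem rowPoint_other (t x : ℤ) {i : Fin n} (hk : i ≠ k) (hm : i ≠ m) :
    rowPoint k m α t x i = α i := by
  simp [rowPoint, planePoint, hk, hm]

theorem degree_rowPoint (hkm : k ≠ m) (t x : ℤ) : degree (rowPoint k m α t x) = t := by
  simp only [rowPoint, planePoint, degree_update, Matrix.cons_val_zero, Matrix.cons_val_one]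
  rw [Function.update_of_ne hkm.symm, otherDegree_eq hkm]
  ring

theorem otherDegree_congr {β γ : Fin n → ℤ} (h : ∀ i, i ≠ k → i ≠ m → β i = γ i) :
    otherDegree k m β = otherDegree k m γ :=
  Finset.sum_congr rfl fun i hi => by
    rw [Finset.mem_filter] at hi
    exact h i hi.2.1 hi.2.2

theorem otherDegree_rowPoint (t x : ℤ) :
    otherDegree k m (rowPoint k m α t x) = otherDegree k m α :=
  otherDegree_congr fun _ hk hm => rowPoint_other t x hk hm

theorem eq_rowPoint (hkm : k ≠ m) {β : Fin n → ℤ} (h : ∀ i, i ≠ k → i ≠ m → β i = α i) :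
    β = rowPoint k m α (degree β) (β k) := by
  funext i
  by_cases hk : i = k
  · subst hk; rw [rowPoint_left hkm]
  by_cases hm : i = m
  · subst hm
    rw [rowPoint_right, ← otherDegree_congr h, otherDegree_eq hkm]
    ring
  · rw [rowPoint_other _ _ hk hm, h i hk hm]

theorem down_left_rowPoint (hkm : k ≠ m) (t x : ℤ) :
    down k (rowPoint k m α t x) = rowPoint k m α (t - 1) (x - 1) := by
  rw [eq_rowPoint hkm (α := α) (β := down k (rowPoint k m α t x)) fun i h1 h2 => by
    rw [down_of_ne h1, rowPoint_other _ _ h1 h2]]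
  rw [degree_down, degree_rowPoint hkm, down_self, rowPoint_left hkm]

theorem down_right_rowPoint (hkm : k ≠ m) (t x : ℤ) :
    down m (rowPoint k m α t x) = rowPoint k m α (t - 1) x := by
  rw [eq_rowPoint hkm (α := α) (β := down m (rowPoint k m α t x)) fun i h1 h2 => by
    rw [down_of_ne h2, rowPoint_other _ _ h1 h2]]
  rw [degree_down, degree_rowPoint hkm, down_of_ne hkm, rowPoint_left hkm]

theorem IsLowest.down_eq_zero {t : ℕ} (hα : D.IsLowest k m t α) (hkm : k ≠ m) {β : Fin n → ℤ}
    (hβ : otherDegree k m β ≤ otherDegree k m α) (ht : (t : ℤ) < degree β) {i : Fin n}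
    (hk : i ≠ k) (hm : i ≠ m) : D (down i β) = 0 := by
  by_contra hc
  have := hα.le _ hc (by rw [degree_down]; omega)
  rw [otherDegree_down_of_ne hkm hk hm] at this
  omega

theorem rowSigns_eq_of_mem {β : Fin n → ℤ} (hkm : k ≠ m) (h : ∀ i, i ≠ k → i ≠ m → β i = α i)
    {t : ℕ} (ht : degree β = t) (h0 : 0 ≤ β k) :
    rowSigns D k m α t ((β k).toNat + 1) = D β := by
  unfold rowSigns
  congr 1
  rw [eq_rowPoint hkm h, ht, rowPoint_left hkm]
  congr 1
  push_cast
  omega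

/-- Rows of a plane of lowest degree in the other variables start and end with a `P`. -/
theorem OnlySourceZero.isRow (hD : D.OnlySourceZero) (hkm : k ≠ m) {t : ℕ}
    (hα : D.IsLowest k m t α) {u : ℕ} (hu : t ≤ u) : IsRow (rowSigns D k m α u) (u + 2) := by
  have hmem : ∀ z : Fin n → ℤ, (∀ i, i ≠ k → i ≠ m → z i = α i) → (u : ℤ) < degree z →
      ∀ j, D (down j z) ≠ 0 → ∀ i, i ≠ k → i ≠ m → down j z i = α i := by
    intro z hz hzu j hj i hk hm
    by_cases hij : i = j
    · subst hij
      exact absurd (hα.down_eq_zero hkm (otherDegree_congr hz).le (by omega) hk hm) hj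
    · rw [down_of_ne hij, hz i hk hm]
  refine ⟨?_, fun x hx => ?_, fun x hx => ?_, fun x hx => ?_⟩
  · by_contra hc
    have := hD.nonneg _ hc k
    rw [rowPoint_left hkm] at this
    simp at this
  · by_contra hc
    have := le_degree_of_nonneg (hD.nonneg _ hc) k
    rw [rowPoint_left hkm, degree_rowPoint hkm] at this
    omega
  · by_contra! hc
    refine hD.not_all_neg {z | (∀ i, i ≠ k → i ≠ m → z i = α i) ∧ z k ≤ (x : ℤ) - 1} (u := u)
      (by omega) ?_ m ?_ ?_ (y := rowPoint k m α u ((x : ℤ) - 1))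
      ⟨fun i => rowPoint_other _ _, (rowPoint_left hkm _ _).le⟩ (degree_rowPoint hkm _ _) hx
    · rintro z ⟨hz, hzk⟩ hzu j hj
      refine ⟨hmem z hz hzu j hj, ?_⟩
      by_cases hkj : k = j
      · subst hkj; rw [down_self]; omega
      · rwa [down_of_ne hkj]
    · rintro z ⟨hz, hzk⟩
      refine ⟨fun i hk hm => by rw [up_of_ne hm, hz i hk hm], by rwa [up_of_ne hkm]⟩
    · rintro z ⟨hz, hzk⟩ hzu hz1
      have h0 := hD.nonneg z (by rw [hz1]; decide) k
      have h1 := rowSigns_eq_of_mem (D := D) hkm hz hzu h0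
      rw [hz1] at h1
      rcases Nat.lt_or_ge ((z k).toNat + 1) x with h | h
      · rw [hc _ h] at h1; exact absurd h1 (by decide)
      · rw [show (z k).toNat + 1 = x by omega] at h1
        rw [hx] at h1; exact absurd h1 (by decide)
  · by_contra! hc
    refine hD.not_all_neg {z | (∀ i, i ≠ k → i ≠ m → z i = α i) ∧
        z m ≤ u - otherDegree k m α - ((x : ℤ) - 1)} (u := u)
      (by omega) ?_ k ?_ ?_ (y := rowPoint k m α u ((x : ℤ) - 1))
      ⟨fun i => rowPoint_other _ _, (rowPoint_right _ _).le⟩ (degree_rowPoint hkm _ _) hx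
    · rintro z ⟨hz, hzk⟩ hzu j hj
      refine ⟨hmem z hz hzu j hj, ?_⟩
      by_cases hkj : m = j
      · subst hkj; rw [down_self]; omega
      · rwa [down_of_ne hkj]
    · rintro z ⟨hz, hzk⟩
      refine ⟨fun i hk hm => by rw [up_of_ne hk, hz i hk hm], by rwa [up_of_ne hkm.symm]⟩
    · rintro z ⟨hz, hzk⟩ hzu hz1
      have h0 := hD.nonneg z (by rw [hz1]; decide) k
      have h1 := rowSigns_eq_of_mem (D := D) hkm hz hzu h0
      have h2 := otherDegree_eq hkm z
      rw [otherDegree_congr hz] at h2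
      rw [hz1] at h1
      rcases Nat.lt_or_ge x ((z k).toNat + 1) with h | h
      · rw [hc _ h] at h1; exact absurd h1 (by decide)
      · rw [show (z k).toNat + 1 = x by omega] at h1
        rw [hx] at h1; exact absurd h1 (by decide)

theorem rowSigns_down_left (D : Diagram n) (hkm : k ≠ m) (u x : ℕ) :
    D (down k (rowPoint k m α (u + 1 : ℕ) x)) = rowSigns D k m α u x := by
  rw [down_left_rowPoint hkm]
  simp [rowSigns]

theorem rowSigns_down_right (D : Diagram n) (hkm : k ≠ m) (u x : ℕ) :
    D (down m (rowPoint k m α (u + 1 : ℕ) x)) = rowSigns D k m α u (x + 1) := by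
  rw [down_right_rowPoint hkm]
  simp [rowSigns]

theorem rowSigns_succ (D : Diagram n) (u x : ℕ) :
    D (rowPoint k m α (u + 1 : ℕ) x) = rowSigns D k m α (u + 1) (x + 1) := by
  simp [rowSigns]

theorem OnlySourceZero.notSource (hD : D.OnlySourceZero) (hkm : k ≠ m) {t : ℕ}
    (hα : D.IsLowest k m t α) {u : ℕ} (hu : t ≤ u) (x : ℕ) :
    NotSource (rowSigns D k m α u x) (rowSigns D k m α u (x + 1))
      (rowSigns D k m α (u + 1) (x + 1)) := by
  by_contra hc
  simp only [NotSource, not_or] at hc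
  obtain ⟨h1, h2, h3, h4⟩ := hc
  have hdeg : degree (rowPoint k m α (u + 1 : ℕ) x) = (u + 1 : ℕ) := degree_rowPoint hkm _ _
  obtain ⟨i, hi⟩ := hD.exists_down_eq_one (α := rowPoint k m α (u + 1 : ℕ) x)
    (ne_zero_of_degree_pos (by rw [hdeg]; push_cast; omega)) (by rwa [rowSigns_succ D]) (by
      by_contra hc
      simp only [Active, not_or, not_exists, not_not] at hc
      refine h4 ⟨by rw [← rowSigns_succ D u x]; exact hc.1, ?_, ?_⟩
      · rw [← rowSigns_down_left D hkm u x]; exact hc.2 k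
      · rw [← rowSigns_down_right D hkm u x]; exact hc.2 m)
  by_cases hk : i = k
  · subst hk; rw [rowSigns_down_left D hkm] at hi; exact h2 hi
  by_cases hm : i = m
  · subst hm; rw [rowSigns_down_right D hkm] at hi; exact h3 hi
  · rw [hα.down_eq_zero hkm (otherDegree_rowPoint _ _).le (by rw [hdeg]; push_cast; omega) hk hm]
      at hi
    exact absurd hi (by decide)

/-- A point of a row at which the row has positive sink weight is a node of `D`. -/
theorem IsLowest.isNode (hkm : k ≠ m) {t : ℕ} (hα : D.IsLowest k m t α) {u : ℕ} (hu : t ≤ u)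
    {x : ℕ} (hw : sinkWeight (rowSigns D k m α u x) (rowSigns D k m α u (x + 1))
      (rowSigns D k m α (u + 1) (x + 1)) ≠ 0) : IsNode D (rowPoint k m α (u + 1 : ℕ) x) := by
  unfold sinkWeight at hw
  rw [← rowSigns_succ D u x, ← rowSigns_down_left D hkm u x, ← rowSigns_down_right D hkm u x] at hw
  have hc := (ite_ne_right_iff.1 hw).1
  obtain ⟨h1, h2, h3, h4⟩ := hc
  have hdeg : degree (rowPoint k m α (u + 1 : ℕ) x) = (u + 1 : ℕ) := degree_rowPoint hkm _ _
  refine Or.inl ⟨?_, fun i => ?_, ?_⟩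
  · rcases sign_cases (D (rowPoint k m α (u + 1 : ℕ) x)) with h | h | h
    · exact Or.inr h
    · exact Or.inl h
    · exact absurd h h1
  · by_cases hk : i = k
    · subst hk
      rcases sign_cases (D (down i (rowPoint i m α (u + 1 : ℕ) x))) with h | h | h
      · exact Or.inr h
      · exact absurd h h2
      · exact Or.inl h
    by_cases hm : i = m
    · subst hm
      rcases sign_cases (D (down i (rowPoint k i α (u + 1 : ℕ) x))) with h | h | h
      · exact Or.inr h
      · exact absurd h h3
      · exact Or.inl h
    · exact Or.inr (hα.down_eq_zero hkm (otherDegree_rowPoint _ _).le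
        (by rw [hdeg]; push_cast; omega) hk hm)
  · rcases h4 with h4 | h4 | h4
    · exact Or.inl h4
    · exact Or.inr ⟨k, h4⟩
    · exact Or.inr ⟨m, h4⟩

end Row

/-! ### Views and the nodes they lift to -/

/-- The point with `k`th entry `a` in the fibre over `β` of the projection that merges the `k`th
and the `m`th coordinate. -/
def fibrePoint {n : ℕ} (k m : Fin (n + 1)) (β : Fin n → ℤ) (a : ℤ) : Fin (n + 1) → ℤ :=
  gamma k m β a (mergedEntry k m β - a)

/-- The projection that merges the `k`th and the `m`th coordinate. -/
def mergePoint {n : ℕ} (k m : Fin (n + 1)) (σ : Fin (n + 1) → ℤ) : Fin n → ℤ := fun j =>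
  if m.succAbove j = k then σ k + σ m else σ (m.succAbove j)

section View

variable {n : ℕ} {D : Diagram (n + 1)} {k m : Fin (n + 1)}

theorem fibrePoint_left (β : Fin n → ℤ) (a : ℤ) : fibrePoint k m β a k = a := by
  simp [fibrePoint, gamma]

theorem fibrePoint_right (hkm : k ≠ m) (β : Fin n → ℤ) (a : ℤ) :
    fibrePoint k m β a m = mergedEntry k m β - a := by
  simp [fibrePoint, gamma, hkm.symm]

theorem fibrePoint_succAbove (β : Fin n → ℤ) (a : ℤ) {j : Fin n} (hj : m.succAbove j ≠ k) :
    fibrePoint k m β a (m.succAbove j) = β j := by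
  simp [fibrePoint, gamma, hj]

theorem mergedEntry_succAbove (β : Fin n → ℤ) (j : Fin n) :
    mergedEntry (m.succAbove j) m β = β j := by
  simp [mergedEntry]

theorem merge_ext {σ τ : Fin (n + 1) → ℤ} (hk : σ k = τ k) (hm : σ m = τ m)
    (h : ∀ j, m.succAbove j ≠ k → σ (m.succAbove j) = τ (m.succAbove j)) : σ = τ := by
  funext i
  by_cases hi : i = m
  · rw [hi, hm]
  obtain ⟨j, rfl⟩ := Fin.exists_succAbove_eq hi
  by_cases hj : m.succAbove j = k
  · rw [hj, hk]
  · exact h j hj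

theorem mergedEntry_mergePoint (hkm : k ≠ m) (σ : Fin (n + 1) → ℤ) :
    mergedEntry k m (mergePoint k m σ) = σ k + σ m := by
  obtain ⟨j, rfl⟩ := Fin.exists_succAbove_eq hkm
  rw [mergedEntry_succAbove, mergePoint, if_pos rfl]

theorem fibrePoint_mergePoint (hkm : k ≠ m) (σ : Fin (n + 1) → ℤ) :
    fibrePoint k m (mergePoint k m σ) (σ k) = σ := by
  refine merge_ext (k := k) (m := m) (fibrePoint_left _ _) ?_ fun j hj => ?_
  · rw [fibrePoint_right hkm, mergedEntry_mergePoint hkm]; ring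
  · rw [fibrePoint_succAbove _ _ hj, mergePoint, if_neg hj]

theorem mergePoint_fibrePoint (hkm : k ≠ m) (β : Fin n → ℤ) (a : ℤ) :
    mergePoint k m (fibrePoint k m β a) = β := by
  funext j
  unfold mergePoint
  split_ifs with hj
  · subst hj
    rw [fibrePoint_left, fibrePoint_right hkm, mergedEntry_succAbove]; ring
  · rw [fibrePoint_succAbove _ _ hj]

theorem fibrePoint_down_of_ne (hkm : k ≠ m) (β : Fin n → ℤ) (a : ℤ) {j : Fin n}
    (hj : m.succAbove j ≠ k) :
    fibrePoint k m (down j β) a = down (m.succAbove j) (fibrePoint k m β a) := by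
  refine merge_ext (k := k) (m := m) ?_ ?_ fun i hi => ?_
  · rw [down_of_ne hj.symm, fibrePoint_left, fibrePoint_left]
  · rw [down_of_ne (Fin.ne_succAbove m j), fibrePoint_right hkm, fibrePoint_right hkm]
    obtain ⟨i, rfl⟩ := Fin.exists_succAbove_eq hkm
    rw [mergedEntry_succAbove, mergedEntry_succAbove, down_of_ne]
    rintro rfl
    exact hj rfl
  · rw [fibrePoint_succAbove _ _ hi]
    by_cases hij : i = j
    · subst hij
      rw [down_self, down_self, fibrePoint_succAbove _ _ hi]
    · rw [down_of_ne hij, down_of_ne (fun h => hij (Fin.succAbove_right_injective h)),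
        fibrePoint_succAbove _ _ hi]

theorem fibrePoint_down_right (β : Fin n → ℤ) (a : ℤ) (j : Fin n) :
    fibrePoint (m.succAbove j) m (down j β) a = down m (fibrePoint (m.succAbove j) m β a) := by
  have hkm := Fin.succAbove_ne m j
  refine merge_ext (k := m.succAbove j) (m := m) ?_ ?_ fun i hi => ?_
  · rw [down_of_ne hkm, fibrePoint_left, fibrePoint_left]
  · rw [down_self, fibrePoint_right hkm, fibrePoint_right hkm, mergedEntry_succAbove,
      mergedEntry_succAbove, down_self]
    ring
  · rw [down_of_ne (Fin.succAbove_ne m i), fibrePoint_succAbove _ _ hi,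
      fibrePoint_succAbove _ _ hi, down_of_ne]
    rintro rfl
    exact hi rfl

theorem down_left_fibrePoint (hkm : k ≠ m) (β : Fin n → ℤ) (a : ℤ) :
    down k (fibrePoint k m β a) = down m (fibrePoint k m β (a - 1)) := by
  refine merge_ext (k := k) (m := m) ?_ ?_ fun i hi => ?_
  · rw [down_self, down_of_ne hkm, fibrePoint_left, fibrePoint_left]
  · rw [down_self, down_of_ne hkm.symm, fibrePoint_right hkm, fibrePoint_right hkm]; ring
  · rw [down_of_ne hi, down_of_ne (Fin.succAbove_ne m i), fibrePoint_succAbove _ _ hi,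
      fibrePoint_succAbove _ _ hi]

theorem view_eq_of_first {β : Fin n → ℤ} {a : ℤ} (h : D (fibrePoint k m β a) ≠ 0)
    (hlt : ∀ a' < a, D (fibrePoint k m β a') = 0) :
    view D k m β = D (fibrePoint k m β a) := by
  have hleast : IsLeast {a : ℤ | D (gamma k m β a (mergedEntry k m β - a)) ≠ 0} a := by
    refine ⟨h, fun b hb => ?_⟩
    by_contra! hc
    exact hb (hlt b hc)
  have hex : ∃ a, IsLeast {a : ℤ | D (gamma k m β a (mergedEntry k m β - a)) ≠ 0} a :=
    ⟨a, hleast⟩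
  unfold view
  rw [dif_pos hex, hex.choose_spec.unique hleast]
  rfl

theorem exists_of_view_ne_zero {β : Fin n → ℤ} (h : view D k m β ≠ 0) :
    ∃ a, D (fibrePoint k m β a) ≠ 0 := by
  unfold view at h
  split_ifs at h with hex
  · exact ⟨_, h⟩
  · exact absurd rfl h

theorem exists_active_of_view {β : Fin n → ℤ} (hkm : k ≠ m) (h : Active (view D k m) β) :
    ∃ a, Active D (fibrePoint k m β a) := by
  rcases h with h | ⟨j, h⟩
  · obtain ⟨a, ha⟩ := exists_of_view_ne_zero h
    exact ⟨a, Or.inl ha⟩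
  · obtain ⟨a, ha⟩ := exists_of_view_ne_zero h
    by_cases hj : m.succAbove j = k
    · subst hj
      rw [fibrePoint_down_right] at ha
      exact ⟨a, Or.inr ⟨m, ha⟩⟩
    · rw [fibrePoint_down_of_ne hkm _ _ hj] at ha
      exact ⟨a, Or.inr ⟨_, ha⟩⟩

/-- In the first active point of a fibre, and below it, `D` only takes values that the view takes
in the projection of this point and below it. -/
theorem OnlySourceZero.exists_first_active (hD : D.OnlySourceZero) (hkm : k ≠ m) {β : Fin n → ℤ}
    (h : Active (view D k m) β) :
    ∃ a, Active D (fibrePoint k m β a) ∧ (∀ a' < a, ¬ Active D (fibrePoint k m β a')) ∧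
      (D (fibrePoint k m β a) = 0 ∨ D (fibrePoint k m β a) = view D k m β) ∧
      ∀ i, D (down i (fibrePoint k m β a)) = 0 ∨
        ∃ j, D (down i (fibrePoint k m β a)) = view D k m (down j β) := by
  obtain ⟨a, ha, hmin⟩ := Int.exists_least_of_bdd (P := fun a => Active D (fibrePoint k m β a))
    ⟨0, fun z hz => by have := hz.nonneg hD k; rwa [fibrePoint_left] at this⟩
    (exists_active_of_view hkm h)
  have hlt : ∀ a' < a, ¬ Active D (fibrePoint k m β a') :=
    fun a' h' hc => absurd (hmin a' hc) (not_le.2 h')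
  have hlt0 : ∀ a' < a, D (fibrePoint k m β a') = 0 := fun a' h' => by
    by_contra hc
    exact hlt a' h' (Or.inl hc)
  have hltd : ∀ a' < a, ∀ i, D (down i (fibrePoint k m β a')) = 0 := fun a' h' i => by
    by_contra hc
    exact hlt a' h' (Or.inr ⟨i, hc⟩)
  refine ⟨a, ha, hlt, ?_, fun i => ?_⟩
  · by_cases h0 : D (fibrePoint k m β a) = 0
    · exact Or.inl h0
    · exact Or.inr (view_eq_of_first h0 hlt0).symm
  · by_cases h0 : D (down i (fibrePoint k m β a)) = 0
    · exact Or.inl h0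
    refine Or.inr ?_
    by_cases hi : i = k
    · subst hi
      rw [down_left_fibrePoint hkm] at h0
      exact absurd (hltd _ (by omega) m) h0
    by_cases hm : i = m
    · subst hm
      obtain ⟨j, rfl⟩ := Fin.exists_succAbove_eq hkm
      refine ⟨j, ?_⟩
      rw [view_eq_of_first (a := a), fibrePoint_down_right]
      · rwa [fibrePoint_down_right]
      · intro a' h'
        rw [fibrePoint_down_right]
        exact hltd a' h' _
    · obtain ⟨j, rfl⟩ := Fin.exists_succAbove_eq hm
      refine ⟨j, ?_⟩
      rw [view_eq_of_first (a := a), fibrePoint_down_of_ne hkm _ _ hi]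
      · rwa [fibrePoint_down_of_ne hkm _ _ hi]
      · intro a' h'
        rw [fibrePoint_down_of_ne hkm _ _ hi]
        exact hltd a' h' _

/-- The nodes of `D` that account for the nodes of the view: the first active points of the fibres
over these. -/
def IsLift (D : Diagram (n + 1)) (k m : Fin (n + 1)) (σ : Fin (n + 1) → ℤ) : Prop :=
  IsNode (view D k m) (mergePoint k m σ) ∧ Active D σ ∧
    ∀ a < σ k, ¬ Active D (fibrePoint k m (mergePoint k m σ) a)

theorem OnlySourceZero.exists_isLift (hD : D.OnlySourceZero) (hkm : k ≠ m) {β : Fin n → ℤ}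
    (h : IsNode (view D k m) β) :
    ∃ σ, mergePoint k m σ = β ∧ IsLift D k m σ ∧ IsNode D σ ∧
      (IsSource (view D k m) β → IsSource D σ) := by
  obtain ⟨a, ha, hlt, h0, hd⟩ := hD.exists_first_active hkm h.active
  have hsrc : IsSource (view D k m) β → IsSource D (fibrePoint k m β a) := by
    rintro ⟨h1, h2, -⟩
    refine ⟨?_, fun i => ?_, ha⟩
    · rcases h0 with h0 | h0
      · exact Or.inr h0
      · rwa [h0]
    · rcases hd i with h3 | ⟨j, h3⟩
      · exact Or.inr h3
      · rw [h3]; exact h2 j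
  refine ⟨fibrePoint k m β a, mergePoint_fibrePoint hkm β a, ?_, ?_, hsrc⟩
  · unfold IsLift
    rw [mergePoint_fibrePoint hkm, fibrePoint_left]
    exact ⟨h, ha, hlt⟩
  · rcases h with h | h
    · obtain ⟨h1, h2, -⟩ := h
      refine Or.inl ⟨?_, fun i => ?_, ha⟩
      · rcases h0 with h0 | h0
        · exact Or.inr h0
        · rwa [h0]
      · rcases hd i with h3 | ⟨j, h3⟩
        · exact Or.inr h3
        · rw [h3]; exact h2 j
    · exact Or.inr (hsrc h)

/-- Nodes that are not lifts of nodes of the view bound the loss of nodes from below. -/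
theorem OnlySourceZero.numNodes_view_add_card_le (hD : D.OnlySourceZero) (hkm : k ≠ m)
    (X : Finset (Fin (n + 1) → ℤ)) (hX : ∀ σ ∈ X, IsNode D σ ∧ ¬ IsLift D k m σ) :
    (view D k m).numNodes + X.card ≤ D.numNodes := by
  classical
  choose! s hs1 hs2 hs3 _ using fun β (h : IsNode (view D k m) β) => hD.exists_isLift hkm h
  have hinj : Set.InjOn s (view D k m).nodes := fun β hβ γ hγ h => by
    rw [← hs1 β hβ, h, hs1 γ hγ]
  have hsub : s '' (view D k m).nodes ⊆ D.nodes := by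
    rintro _ ⟨β, hβ, rfl⟩
    exact hs3 β hβ
  have hdisj : Disjoint (s '' (view D k m).nodes) (X : Set (Fin (n + 1) → ℤ)) := by
    rw [Set.disjoint_left]
    rintro _ ⟨β, hβ, rfl⟩ h
    exact (hX _ h).2 (hs2 β hβ)
  have hfin := hD.finite_nodes
  unfold numNodes
  rw [← hinj.ncard_image, ← Set.ncard_coe_finset,
    ← Set.ncard_union_eq hdisj (hfin.subset hsub) X.finite_toSet]
  exact Set.ncard_le_ncard (Set.union_subset hsub fun σ h => (hX σ h).1) hfin

/-- If `D` is nonzero at `σ - e_k`, then `σ - e_k + e_m` is an earlier active point of the fibre. -/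
theorem not_isLift_of_down (hkm : k ≠ m) {σ : Fin (n + 1) → ℤ} (h : D (down k σ) ≠ 0) :
    ¬ IsLift D k m σ := by
  rintro ⟨-, -, hlt⟩
  refine hlt (σ k - 1) (by omega) (Or.inr ⟨m, ?_⟩)
  rwa [← down_left_fibrePoint hkm, fibrePoint_mergePoint hkm]

theorem IsLift.eq_of_mergePoint_eq {σ τ : Fin (n + 1) → ℤ} (hkm : k ≠ m) (hσ : IsLift D k m σ)
    (hτ : IsLift D k m τ) (h : mergePoint k m σ = mergePoint k m τ) : σ = τ := by
  have key : ∀ σ τ, IsLift D k m σ → IsLift D k m τ → mergePoint k m σ = mergePoint k m τ →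
      σ k ≤ τ k := by
    intro σ τ hσ hτ h
    by_contra! hc
    refine hσ.2.2 _ hc ?_
    rw [h, fibrePoint_mergePoint hkm]
    exact hτ.2.1
  have hk : σ k = τ k := le_antisymm (key σ τ hσ hτ h) (key τ σ hτ hσ h.symm)
  rw [← fibrePoint_mergePoint hkm σ, ← fibrePoint_mergePoint hkm τ, h, hk]

theorem fibrePoint_eq_rowPoint (hkm : k ≠ m) {α : Fin (n + 1) → ℤ} (t x a : ℤ) :
    fibrePoint k m (mergePoint k m (rowPoint k m α t x)) a = rowPoint k m α t a := by
  refine merge_ext (k := k) (m := m) ?_ ?_ fun j hj => ?_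
  · rw [fibrePoint_left, rowPoint_left hkm]
  · rw [fibrePoint_right hkm, mergedEntry_mergePoint hkm, rowPoint_left hkm, rowPoint_right,
      rowPoint_right]
    ring
  · rw [fibrePoint_succAbove _ _ hj, mergePoint, if_neg hj,
      rowPoint_other _ _ hj (Fin.succAbove_ne m j), rowPoint_other _ _ hj (Fin.succAbove_ne m j)]

theorem mergePoint_rowPoint (hkm : k ≠ m) {α : Fin (n + 1) → ℤ} (t x y : ℤ) :
    mergePoint k m (rowPoint k m α t x) = mergePoint k m (rowPoint k m α t y) := by
  rw [← fibrePoint_eq_rowPoint hkm t y x, mergePoint_fibrePoint hkm]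

/-- Over a nonzero row of positive degree the view has a `P`, hence no node, since a node there
would be a source and lift to a source of `D`. -/
theorem OnlySourceZero.not_isLift_of_row (hD : D.OnlySourceZero) (hkm : k ≠ m)
    {α : Fin (n + 1) → ℤ} {t : ℕ} {L : ℕ} (hrow : IsRow (rowSigns D k m α t) L)
    (hne : ∃ x, rowSigns D k m α t x ≠ 0) (ht : 0 < t) (x : ℤ) :
    ¬ IsLift D k m (rowPoint k m α t x) := by
  rintro ⟨hnode, -, -⟩
  obtain ⟨y, hy⟩ := hne
  have hy0 : nextSign (rowSigns D k m α t) 0 ≠ 0 := by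
    unfold nextSign
    have hex : ∃ y, 0 < y ∧ rowSigns D k m α t y ≠ 0 := by
      refine ⟨y, Nat.pos_of_ne_zero ?_, hy⟩
      rintro rfl
      exact hy hrow.zero
    classical
    rw [dif_pos hex]
    exact (Nat.find_spec hex).2
  have hP : nextSign (rowSigns D k m α t) 0 = 1 := by
    rcases sign_cases (nextSign (rowSigns D k m α t) 0) with h | h | h
    · exact absurd h hy0
    · exact absurd h hrow.nextSign_zero
    · exact h
  obtain ⟨z, hz0, hz, hzf⟩ := exists_first_of_nextSign_ne_zero hy0
  rw [hP] at hz
  have hview : view D k m (mergePoint k m (rowPoint k m α t x)) = 1 := by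
    have hz' : D (rowPoint k m α t ((z : ℤ) - 1)) = 1 := hz
    rw [view_eq_of_first (a := (z : ℤ) - 1), fibrePoint_eq_rowPoint hkm, hz']
    · rw [fibrePoint_eq_rowPoint hkm, hz']; decide
    · intro a ha
      rw [fibrePoint_eq_rowPoint hkm]
      by_contra hc
      have h0 := hD.nonneg _ hc k
      rw [rowPoint_left hkm] at h0
      refine hc ?_
      have := hzf (a.toNat + 1) (by omega) (by omega)
      unfold rowSigns at this
      rwa [show ((a.toNat + 1 : ℕ) : ℤ) - 1 = a by push_cast; omega] at this
  have hsrc : IsSource (view D k m) (mergePoint k m (rowPoint k m α t x)) := by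
    rcases hnode with h | h
    · have := h.1
      rw [hview] at this
      exact absurd this (by decide)
    · exact h
  obtain ⟨σ, hσ, -, -, hlift⟩ := hD.exists_isLift hkm hnode
  have h0 : σ = 0 := (hD.source σ).1 (hlift hsrc)
  have hdeg : degree (rowPoint k m α t (σ k)) = t := degree_rowPoint hkm _ _
  rw [← fibrePoint_eq_rowPoint hkm t x, ← hσ, fibrePoint_mergePoint hkm, h0, degree_zero] at hdeg
  omega

end View

/-! ### Counting the nodes lost in a view -/

section Count

variable {n : ℕ} {D : Diagram (n + 1)} {k m : Fin (n + 1)}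

/-- `D` is nonzero at `σ`, at `σ - e_k` and at `σ - e_m`. -/
def IsFacialAt (D : Diagram (n + 1)) (k m : Fin (n + 1)) (σ : Fin (n + 1) → ℤ) : Prop :=
  D σ ≠ 0 ∧ D (down k σ) ≠ 0 ∧ D (down m σ) ≠ 0

/-- A node of `D` that does not account for a node of the view, and whose degree in the other
variables is at most that of every nonzero point in the preceding degree. -/
structure IsSpareNode (D : Diagram (n + 1)) (k m : Fin (n + 1)) (σ : Fin (n + 1) → ℤ) : Prop where
  isNode : IsNode D σ
  not_isLift : ¬ IsLift D k m σ
  le : ∀ β, D β ≠ 0 → degree β = degree σ - 1 → otherDegree k m σ ≤ otherDegree k m β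

open Classical in
/-- The spare nodes in the row above the one through `α`: all its nodes if this row is nonzero, and
all but at most one otherwise. -/
theorem OnlySourceZero.exists_spare_row (hD : D.OnlySourceZero) (hkm : k ≠ m) {t : ℕ}
    {α : Fin (n + 1) → ℤ} (hα : D.IsLowest k m t α) :
    ∃ X : Finset (Fin (n + 1) → ℤ), (∀ σ ∈ X, IsSpareNode D k m σ ∧ degree σ = t + 1) ∧
      1 + rowWeight (rowSigns D k m α t) (t + 2) - rowWeight (rowSigns D k m α (t + 1)) (t + 3) -
          (if ∃ x, rowSigns D k m α (t + 1) x ≠ 0 then 0 else 1) ≤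
        (X.card : ℤ) + (X.filter (IsFacialAt D k m)).card := by
  set f := rowSigns D k m α t with hf
  set g := rowSigns D k m α (t + 1) with hg
  have hfrow : IsRow f (t + 2) := hD.isRow hkm hα le_rfl
  have hgrow : IsRow g (t + 3) := hD.isRow hkm hα (Nat.le_succ t)
  have hfne : ∃ x, f x ≠ 0 := by
    refine ⟨(α k).toNat + 1, ?_⟩
    rw [hf, rowSigns_eq_of_mem hkm (fun _ _ _ => rfl) hα.degree_eq (hD.nonneg α hα.ne_zero k)]
    exact hα.ne_zero
  have hrow := one_add_rowWeight_sub_le hfrow hgrow hfne (hD.notSource hkm hα le_rfl)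
  rw [rowWeight_succ_of_bound hfrow] at hrow
  set w : ℕ → ℤ := fun x => sinkWeight (f x) (f (x + 1)) (g (x + 1)) with hw
  have hrow' : 1 + rowWeight f (t + 2) - rowWeight g (t + 3) ≤
      ∑ x ∈ Finset.range (t + 3), w x := hrow
  set pt : ℕ → Fin (n + 1) → ℤ := fun x => rowPoint k m α (t + 1 : ℕ) x with hpt
  have hinj : Function.Injective pt := fun x y h => by
    have := congrFun h k
    simp only [hpt, rowPoint_left hkm] at this
    exact_mod_cast this
  set W := (Finset.range (t + 3)).filter fun x => w x ≠ 0 with hW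
  set R := W.image pt with hR
  have hwval : ∀ x ∈ W, w x = 1 + if IsFacialAt D k m (pt x) then 1 else 0 := by
    intro x hx
    have hx := (Finset.mem_filter.1 hx).2
    have e : IsFacialAt D k m (pt x) ↔ (g (x + 1) ≠ 0 ∧ f x ≠ 0 ∧ f (x + 1) ≠ 0) := by
      rw [hf, hg, ← rowSigns_succ D t x, ← rowSigns_down_left D hkm t x,
        ← rowSigns_down_right D hkm t x]
      rfl
    simp only [hw, sinkWeight] at hx ⊢
    rw [if_pos (ite_ne_right_iff.1 hx).1, if_congr e rfl rfl]
    split_ifs <;> rfl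
  have hsum : (R.card : ℤ) + (R.filter (IsFacialAt D k m)).card =
      ∑ x ∈ Finset.range (t + 3), w x := by
    rw [← Finset.sum_filter_ne_zero, ← hW, Finset.sum_congr rfl hwval, Finset.sum_add_distrib,
      hR, Finset.filter_image, Finset.card_image_of_injective _ hinj,
      Finset.card_image_of_injective _ hinj, Finset.sum_const, nsmul_one, Finset.sum_boole]
  have hRprop : ∀ σ ∈ R, IsNode D σ ∧ degree σ = t + 1 ∧
      (∀ β, D β ≠ 0 → degree β = degree σ - 1 → otherDegree k m σ ≤ otherDegree k m β) ∧
      ∃ x : ℕ, σ = pt x := by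
    intro σ hσ
    obtain ⟨x, hx, rfl⟩ := Finset.mem_image.1 hσ
    have hdeg : degree (pt x) = t + 1 := by
      rw [hpt, degree_rowPoint hkm]; push_cast; ring
    refine ⟨hα.isNode hkm le_rfl (Finset.mem_filter.1 hx).2, hdeg, fun β hβ hβd => ?_, x, rfl⟩
    rw [hpt, otherDegree_rowPoint]
    exact hα.le β hβ (by omega)
  by_cases hgne : ∃ x, g x ≠ 0
  · refine ⟨R, fun σ hσ => ?_, ?_⟩
    · obtain ⟨h1, h2, h3, x, rfl⟩ := hRprop σ hσ
      exact ⟨⟨h1, hD.not_isLift_of_row hkm hgrow hgne (Nat.succ_pos t) _, h3⟩, h2⟩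
    · rw [if_pos hgne, hsum]
      linarith
  · refine ⟨R.filter fun σ => ¬ IsLift D k m σ, fun σ hσ => ?_, ?_⟩
    · obtain ⟨hσ, hσl⟩ := Finset.mem_filter.1 hσ
      obtain ⟨h1, h2, h3, -⟩ := hRprop σ hσ
      exact ⟨⟨h1, hσl, h3⟩, h2⟩
    · have hnf : R.filter (IsFacialAt D k m) = ∅ := by
        refine Finset.filter_eq_empty_iff.2 fun σ hσ hfac => ?_
        obtain ⟨x, -, rfl⟩ := Finset.mem_image.1 hσ
        refine hgne ⟨x + 1, ?_⟩
        rw [hg, ← rowSigns_succ D t x]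
        exact hfac.1
      rw [hnf, Finset.card_empty] at hsum
      have hone : (R.filter (IsLift D k m)).card ≤ 1 := by
        refine Finset.card_le_one.2 fun σ hσ τ hτ => ?_
        obtain ⟨hσ, hσl⟩ := Finset.mem_filter.1 hσ
        obtain ⟨hτ, hτl⟩ := Finset.mem_filter.1 hτ
        obtain ⟨x, -, rfl⟩ := Finset.mem_image.1 hσ
        obtain ⟨y, -, rfl⟩ := Finset.mem_image.1 hτ
        exact hσl.eq_of_mergePoint_eq hkm hτl (mergePoint_rowPoint hkm _ _ _)
      have hsplit := Finset.card_filter_add_card_filter_not (s := R) (IsLift D k m)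
      rw [if_neg hgne]
      push_cast at hsum
      omega

open Classical in
/-- Collecting spare nodes from degree `t` upwards.  The plane is kept as long as its rows are
nonzero; after that the count continues in any lowest plane of the next degree, where the weight
`≥ 1` of the new row makes up for the node that may be a lift. -/
theorem OnlySourceZero.exists_spare_above (hD : D.OnlySourceZero) {T : ℕ} (hT : D.IsTopDegree T)
    (hkm : k ≠ m) (s : ℕ) : ∀ t : ℕ, t + s = T → ∀ α, D.IsLowest k m t α →
      ∃ X : Finset (Fin (n + 1) → ℤ), (∀ σ ∈ X, IsSpareNode D k m σ ∧ (t : ℤ) + 1 ≤ degree σ) ∧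
        s + rowWeight (rowSigns D k m α t) (t + 2) ≤
          (X.card : ℤ) + (X.filter (IsFacialAt D k m)).card := by
  induction s with
  | zero =>
    intro t ht α hα
    obtain ⟨X, hX, hc⟩ := hD.exists_spare_row hkm hα
    refine ⟨X, fun σ hσ => ⟨(hX σ hσ).1, (hX σ hσ).2.ge⟩, ?_⟩
    have hg : ∀ x, rowSigns D k m α (t + 1) x = 0 := by
      intro x
      by_contra hc
      have := hT.le _ hc
      rw [degree_rowPoint hkm] at this
      push_cast at this
      omega
    rw [if_neg (by push Not; exact hg), rowWeight_of_zero hg] at hc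
    push_cast
    linarith
  | succ s ih =>
    intro t ht α hα
    obtain ⟨X, hX, hc⟩ := hD.exists_spare_row hkm hα
    -- it suffices to continue from some lowest point of the next degree with a suitable weight
    suffices h : ∃ α', D.IsLowest k m (t + 1) α' ∧
        1 + rowWeight (rowSigns D k m α t) (t + 2) -
          rowWeight (rowSigns D k m α' (t + 1)) (t + 3) ≤
        (X.card : ℤ) + (X.filter (IsFacialAt D k m)).card by
      obtain ⟨α', hα', hc'⟩ := h
      obtain ⟨Y, hY, hcY⟩ := ih (t + 1) (by omega) α' hα'
      have hdisj : Disjoint X Y := by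
        rw [Finset.disjoint_left]
        intro σ h1 h2
        have h3 := (hX σ h1).2
        have h4 := (hY σ h2).2
        push_cast at h4
        omega
      refine ⟨X ∪ Y, fun σ hσ => ?_, ?_⟩
      · rcases Finset.mem_union.1 hσ with h | h
        · exact ⟨(hX σ h).1, (hX σ h).2.ge⟩
        · refine ⟨(hY σ h).1, ?_⟩
          have := (hY σ h).2
          push_cast at this
          omega
      · rw [Finset.filter_union, Finset.card_union_of_disjoint hdisj,
          Finset.card_union_of_disjoint (Finset.disjoint_filter_filter hdisj)]
        push_cast
        linarith
    by_cases hne : ∃ x, rowSigns D k m α (t + 1) x ≠ 0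
    · rw [if_pos hne] at hc
      obtain ⟨x, hx⟩ := hne
      refine ⟨rowPoint k m α (t + 1 : ℕ) ((x : ℤ) - 1), ⟨hx, degree_rowPoint hkm _ _, ?_⟩, ?_⟩
      · intro β hβ hβt
        rw [otherDegree_rowPoint]
        exact hα.le β hβ (by push_cast at hβt; omega)
      · have hsame : rowSigns D k m (rowPoint k m α (t + 1 : ℕ) ((x : ℤ) - 1)) (t + 1) =
            rowSigns D k m α (t + 1) := by
          funext y
          unfold rowSigns
          congr 1
          rw [eq_rowPoint hkm (α := α) (β := rowPoint k m (rowPoint k m α (t + 1 : ℕ) ((x : ℤ) - 1))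
            (t + 1 : ℕ) ((y : ℤ) - 1)) fun i h1 h2 => by
            rw [rowPoint_other _ _ h1 h2, rowPoint_other _ _ h1 h2], degree_rowPoint hkm,
            rowPoint_left hkm]
        rw [hsame]
        linarith
    · rw [if_neg hne] at hc
      obtain ⟨α', hα'⟩ := hD.exists_isLowest hkm (hD.exists_degree_eq hT (t := t + 1) (by omega))
      refine ⟨α', hα', ?_⟩
      push Not at hne
      rw [rowWeight_of_zero hne] at hc
      have := one_le_rowWeight (hD.isRow hkm hα' le_rfl)
        ⟨(α' k).toNat + 1, by
          rw [rowSigns_eq_of_mem hkm (fun _ _ _ => rfl) hα'.degree_eq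
            (hD.nonneg α' hα'.ne_zero k)]
          exact hα'.ne_zero⟩
      linarith

open Classical in
/-- In the view along `(k, m)` at least as many nodes are lost as `D` has rows, if the facial nodes
on the edge `(x_k, x_m)` are counted twice. -/
theorem OnlySourceZero.exists_spare (hD : D.OnlySourceZero) {T : ℕ} (hT : D.IsTopDegree T)
    (hkm : k ≠ m) : ∃ X : Finset (Fin (n + 1) → ℤ), (∀ σ ∈ X, IsSpareNode D k m σ) ∧
      T + 1 ≤ X.card + (X.filter (IsFacialAt D k m)).card := by
  obtain ⟨α, hα⟩ := hD.exists_isLowest hkm (hD.exists_degree_eq hT (Nat.zero_le T))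
  obtain ⟨X, hX, hc⟩ := hD.exists_spare_above hT hkm T 0 (by omega) α hα
  refine ⟨X, fun σ hσ => (hX σ hσ).1, ?_⟩
  have := one_le_rowWeight (hD.isRow hkm hα le_rfl)
    ⟨(α k).toNat + 1, by
      rw [rowSigns_eq_of_mem hkm (fun _ _ _ => rfl) hα.degree_eq (hD.nonneg α hα.ne_zero k)]
      exact hα.ne_zero⟩
  omega

theorem IsSpareNode.down_eq_zero (hkm : k ≠ m) {σ : Fin (n + 1) → ℤ} (hσ : IsSpareNode D k m σ)
    {i : Fin (n + 1)} (hk : i ≠ k) (hm : i ≠ m) : D (down i σ) = 0 := by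
  by_contra hc
  have := hσ.le _ hc (degree_down i σ)
  rw [otherDegree_down_of_ne hkm hk hm] at this
  omega

/-- The nodes of `D` that have exactly two nonzero points below them, in the directions `k` and
`m`. -/
def pairNodes (D : Diagram (n + 1)) (k m : Fin (n + 1)) : Set (Fin (n + 1) → ℤ) :=
  {σ | IsNode D σ ∧ D (down k σ) ≠ 0 ∧ D (down m σ) ≠ 0 ∧
    ∀ i, i ≠ k → i ≠ m → D (down i σ) = 0}

theorem OnlySourceZero.finite_pairNodes (hD : D.OnlySourceZero) (k m : Fin (n + 1)) :
    (pairNodes D k m).Finite := hD.finite_nodes.subset fun _ h => h.1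

/-- The facial deficit of one edge against the gain from the other edges at the vertex `k`: nodes
with nonzero points below them in the directions `k` and `i` are lost in the view along `(k, m)`. -/
theorem OnlySourceZero.card_add_sum_pairNodes_le (hD : D.OnlySourceZero) {T : ℕ}
    (hT : D.IsTopDegree T) (hkm : k ≠ m) :
    (view D k m).numNodes + (T + 1) +
        ∑ i ∈ (Finset.univ.erase k).erase m, (pairNodes D k i).ncard ≤
      D.numNodes + (pairNodes D k m).ncard := by
  classical
  obtain ⟨X, hX, hc⟩ := hD.exists_spare hT hkm
  set A : Fin (n + 1) → Finset (Fin (n + 1) → ℤ) := fun i => (hD.finite_pairNodes k i).toFinset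
    with hA
  have hmem : ∀ i σ, σ ∈ A i ↔ σ ∈ pairNodes D k i := fun i σ => by simp [hA]
  have hcard : ∀ i, (A i).card = (pairNodes D k i).ncard := fun i =>
    (Set.ncard_eq_toFinset_card _ (hD.finite_pairNodes k i)).symm
  have hI : ∀ i ∈ (Finset.univ.erase k).erase m, i ≠ k ∧ i ≠ m := fun i hi => by
    simpa [and_comm] using hi
  have hpd : ((((Finset.univ.erase k).erase m : Finset (Fin (n + 1))) :
      Set (Fin (n + 1)))).PairwiseDisjoint A := by
    intro i hi j hj hij
    rw [Function.onFun, Finset.disjoint_left]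
    intro σ h1 h2
    rw [hmem] at h1 h2
    exact h1.2.2.1 (h2.2.2.2 i (hI i hi).1 hij)
  have hdisj : Disjoint X (((Finset.univ.erase k).erase m).biUnion A) := by
    rw [Finset.disjoint_biUnion_right]
    intro i hi
    rw [Finset.disjoint_left]
    intro σ h1 h2
    rw [hmem] at h2
    exact h2.2.2.1 ((hX σ h1).down_eq_zero hkm (hI i hi).1 (hI i hi).2)
  have hfac : (X.filter (IsFacialAt D k m)).card ≤ (pairNodes D k m).ncard := by
    rw [← hcard]
    refine Finset.card_le_card fun σ hσ => ?_
    obtain ⟨h1, h2⟩ := Finset.mem_filter.1 hσ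
    rw [hmem]
    exact ⟨(hX σ h1).isNode, h2.2.1, h2.2.2, fun i => (hX σ h1).down_eq_zero hkm⟩
  have hle := hD.numNodes_view_add_card_le hkm (X ∪ ((Finset.univ.erase k).erase m).biUnion A)
    (fun σ hσ => by
      rcases Finset.mem_union.1 hσ with h | h
      · exact ⟨(hX σ h).isNode, (hX σ h).not_isLift⟩
      · obtain ⟨i, -, h⟩ := Finset.mem_biUnion.1 h
        rw [hmem] at h
        exact ⟨h.1, not_isLift_of_down hkm h.2.1⟩)
  rw [Finset.card_union_of_disjoint hdisj, Finset.card_biUnion hpd,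
    Finset.sum_congr rfl fun i _ => hcard i] at hle
  omega

/-- Comparing the edges at a vertex: an edge with the fewest facial nodes among those at `k` gains
more from the others than it lacks itself. -/
theorem OnlySourceZero.exists_lt_of_pairNodes (hD : D.OnlySourceZero) {T : ℕ}
    (hT : D.IsTopDegree T) (hn : 4 ≤ n + 1) {k i : Fin (n + 1)} (hki : k ≠ i)
    (hne : (pairNodes D k i).ncard ≠ 0) :
    ∃ m, k ≠ m ∧ (view D k m).numNodes + (T + 1) < D.numNodes := by
  obtain ⟨m, hm, hmin⟩ := Finset.exists_min_image (Finset.univ.erase k)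
    (fun j => (pairNodes D k j).ncard) ⟨i, by simp [hki.symm]⟩
  have hkm : k ≠ m := by simpa [eq_comm] using hm
  refine ⟨m, hkm, ?_⟩
  have h := hD.card_add_sum_pairNodes_le hT hkm
  have hlt : (pairNodes D k m).ncard <
      ∑ i ∈ (Finset.univ.erase k).erase m, (pairNodes D k i).ncard := by
    rcases Nat.eq_zero_or_pos (pairNodes D k m).ncard with h0 | h0
    · rw [h0]
      have him : i ≠ m := by
        rintro rfl
        exact hne h0
      exact (Nat.pos_of_ne_zero hne).trans_le
        (Finset.single_le_sum (f := fun j => (pairNodes D k j).ncard) (fun _ _ => Nat.zero_le _)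
          (by simp [him, hki.symm]))
    · have hcard : ((Finset.univ.erase k).erase m).card = n - 1 := by
        rw [Finset.card_erase_of_mem hm, Finset.card_erase_of_mem (Finset.mem_univ k)]
        simp
      have h1 := Finset.card_nsmul_le_sum ((Finset.univ.erase k).erase m)
        (fun j => (pairNodes D k j).ncard) (pairNodes D k m).ncard
        (fun j hj => hmin j (Finset.mem_of_mem_erase hj))
      rw [hcard, smul_eq_mul] at h1
      have h2 : 2 * (pairNodes D k m).ncard ≤ (n - 1) * (pairNodes D k m).ncard :=
        Nat.mul_le_mul_right _ (by omega)
      omega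
  omega

/-- A node with a nonzero point below it in the direction `k` is spare for the edge `(k, m)`.  If it
does not lie lowest in the other variables, it is not among the nodes counted for this edge, and
the bound is not sharp. -/
theorem OnlySourceZero.exists_lt_of_lower (hD : D.OnlySourceZero) {T : ℕ}
    (hT : D.IsTopDegree T) (hn : 4 ≤ n + 1) (hkm : k ≠ m) {σ β : Fin (n + 1) → ℤ}
    (hσ : IsNode D σ) (hk : D (down k σ) ≠ 0) (hβ : D β ≠ 0) (hβσ : degree β = degree σ - 1)
    (hlt : otherDegree k m β < otherDegree k m σ) :
    ∃ k m, k ≠ m ∧ (view D k m).numNodes + (T + 1) < D.numNodes := by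
  classical
  by_cases hpair : (pairNodes D k m).ncard = 0
  · refine ⟨k, m, hkm, ?_⟩
    obtain ⟨X, hX, hc⟩ := hD.exists_spare hT hkm
    have hfac : (X.filter (IsFacialAt D k m)) = ∅ := by
      refine Finset.filter_eq_empty_iff.2 fun τ hτ h2 => ?_
      rw [Set.ncard_eq_zero (hD.finite_pairNodes k m)] at hpair
      have : τ ∈ pairNodes D k m :=
        ⟨(hX τ hτ).isNode, h2.2.1, h2.2.2, fun i => (hX τ hτ).down_eq_zero hkm⟩
      rw [hpair] at this
      exact this
    have hσX : σ ∉ X := fun h => absurd ((hX σ h).le β hβ hβσ) (not_le.2 hlt)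
    have := hD.numNodes_view_add_card_le hkm (insert σ X) (fun τ hτ => by
      rcases Finset.mem_insert.1 hτ with rfl | h
      · exact ⟨hσ, not_isLift_of_down hkm hk⟩
      · exact ⟨(hX τ h).isNode, (hX τ h).not_isLift⟩)
    rw [Finset.card_insert_of_notMem hσX] at this
    rw [hfac, Finset.card_empty] at hc
    omega
  · obtain ⟨m', h1, h2⟩ := hD.exists_lt_of_pairNodes hT hn hkm hpair
    exact ⟨k, m', h1, h2⟩

theorem OnlySourceZero.exists_lt_of_two_down (hD : D.OnlySourceZero) {T : ℕ}
    (hT : D.IsTopDegree T) (hn : 4 ≤ n + 1) {σ : Fin (n + 1) → ℤ} (hσ : IsNode D σ)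
    {k i : Fin (n + 1)} (hki : k ≠ i) (hk : D (down k σ) ≠ 0) (hi : D (down i σ) ≠ 0) :
    ∃ k m, k ≠ m ∧ (view D k m).numNodes + (T + 1) < D.numNodes := by
  obtain ⟨m, hm⟩ : ∃ m, m ∉ ({k, i} : Finset (Fin (n + 1))) :=
    Finset.exists_mem_notMem_of_card_lt_card (s := {k, i}) (t := Finset.univ) (by
      have := Finset.card_le_two (a := k) (b := i)
      rw [Finset.card_univ, Fintype.card_fin]
      omega) |>.imp fun _ h => h.2
  simp only [Finset.mem_insert, Finset.mem_singleton, not_or] at hm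
  have hkm : k ≠ m := Ne.symm hm.1
  refine hD.exists_lt_of_lower hT hn hkm hσ hk hi (degree_down i σ) ?_
  rw [otherDegree_down_of_ne hkm hki.symm (Ne.symm hm.2)]
  omega

theorem OnlySourceZero.exists_le (hD : D.OnlySourceZero) {T : ℕ} (hT : D.IsTopDegree T)
    (hn : 4 ≤ n + 1) : ∃ k m, k ≠ m ∧ (view D k m).numNodes + (T + 1) ≤ D.numNodes := by
  obtain ⟨k, m, hkm⟩ : ∃ k m : Fin (n + 1), k ≠ m :=
    ⟨⟨0, by omega⟩, ⟨1, by omega⟩, by simp [Fin.ext_iff]⟩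
  by_cases h : (pairNodes D k m).ncard = 0
  · have := hD.card_add_sum_pairNodes_le hT hkm
    exact ⟨k, m, hkm, by omega⟩
  · obtain ⟨m', h1, h2⟩ := hD.exists_lt_of_pairNodes hT hn hkm h
    exact ⟨k, m', h1, h2.le⟩

end Count

/-! ### Facial nodes of complete sets -/

section CompleteSet

variable {n : ℕ} {D : Diagram n} {k m : Fin n}

theorem planePoint_down_zero (hkm : k ≠ m) (α : Fin n → ℤ) (v : Fin 2 → ℤ) :
    planePoint k m α (down 0 v) = down k (planePoint k m α v) := by
  funext i
  by_cases hm : i = m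
  · subst hm
    rw [down_of_ne hkm.symm]
    simp [planePoint, down]
  by_cases hk : i = k
  · subst hk
    rw [down_self]
    simp [planePoint, hm]
  · rw [down_of_ne hk]
    simp [planePoint, hm, hk]

theorem planePoint_down_one (α : Fin n → ℤ) (v : Fin 2 → ℤ) :
    planePoint k m α (down 1 v) = down m (planePoint k m α v) := by
  funext i
  by_cases hm : i = m
  · subst hm
    rw [down_self]
    simp [planePoint]
  · rw [down_of_ne hm]
    by_cases hk : i = k
    · subst hk
      simp [planePoint, hm, down]
    · simp [planePoint, hm, hk]

theorem otherDegree_planePoint (α : Fin n → ℤ) (v : Fin 2 → ℤ) :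
    otherDegree k m (planePoint k m α v) = otherDegree k m α :=
  otherDegree_congr fun i hk hm => by simp [planePoint, hk, hm]

theorem facePart_ne_zero {α : Fin n → ℤ} {S : Set (Fin 2 → ℤ)} {r : ℤ} {v : Fin 2 → ℤ}
    (h : facePart D k m α S r v ≠ 0) :
    r ≤ degree (planePoint k m α v) ∧ facePart D k m α S r v = D (planePoint k m α v) := by
  unfold facePart at h ⊢
  split_ifs at h ⊢ with h1
  · exact ⟨h1.2, rfl⟩
  · exact absurd rfl h

theorem IsFacialNode.ne_zero {F : Diagram 2} {v : Fin 2 → ℤ} (h : F.IsFacialNode v) :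
    F v ≠ 0 ∧ ∀ i, F (down i v) ≠ 0 := by
  rcases h.2 with ⟨h0, h1⟩ | ⟨-, h1⟩
  · refine ⟨h0, ?_⟩
    have : (Finset.univ.filter fun i => F (down i v) ≠ 0) = Finset.univ := by
      rw [← Finset.card_eq_iff_eq_univ, Fintype.card_fin]
      exact h1
    intro i
    have hi := Finset.mem_univ i
    rw [← this] at hi
    exact (Finset.mem_filter.1 hi).2
  · have : numDown F v ≤ 2 := (Finset.card_le_univ _).trans_eq (Fintype.card_fin 2)
    omega

/-- The members of a complete set lie in planes of lowest degree in the other variables, where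
above the bottom row only the directions of the plane matter.  Hence their facial nodes are nodes
of `D`. -/
theorem IsCompleteFrom.exists_node (hD : D.OnlySourceZero) (hkm : k ≠ m) {r : ℤ}
    {𝓕 : List (Diagram 2)} (h : IsCompleteFrom D k m r 𝓕) (hr : 0 ≤ r) {F : Diagram 2}
    (hF : F ∈ 𝓕) {v : Fin 2 → ℤ} (hv : F.IsFacialNode v) :
    ∃ σ, IsNode D σ ∧ D (down k σ) ≠ 0 ∧ D (down m σ) ≠ 0 := by
  induction h with
  | nil r h => simp at hF
  | cons r α S 𝓕 hα hrα hmin hS hαS h𝓕 ih =>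
    rcases List.mem_cons.1 hF with rfl | hF
    · have hlow : D.IsLowest k m r.toNat α := by
        have e : (r.toNat : ℤ) = r := Int.toNat_of_nonneg hr
        exact hD.isLowest hkm hα (by rw [hrα, e]) (by rw [e]; exact hmin)
      obtain ⟨h0, hd⟩ := hv.ne_zero
      have e := (facePart_ne_zero h0).2
      obtain ⟨d0, e0⟩ := facePart_ne_zero (hd 0)
      have e1 := (facePart_ne_zero (hd 1)).2
      have hd0 := hd 0
      have hd1 := hd 1
      rw [planePoint_down_zero hkm] at e0 d0
      rw [planePoint_down_one] at e1
      rw [degree_down] at d0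
      have hother : ∀ i, i ≠ k → i ≠ m → D (down i (planePoint k m α v)) = 0 := fun i =>
        hlow.down_eq_zero hkm (otherDegree_planePoint α v).le (by omega)
      refine ⟨planePoint k m α v, ?_, by rwa [← e0], by rwa [← e1]⟩
      rcases hv.1 with ⟨s1, s2, -⟩ | ⟨s1, s2, -⟩
      · refine Or.inl ⟨by rwa [← e], fun i => ?_, Or.inl (by rwa [← e])⟩
        by_cases hk : i = k
        · subst hk; rw [← e0]; exact s2 0
        by_cases hm : i = m
        · subst hm; rw [← e1]; exact s2 1
        · exact Or.inr (hother i hk hm)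
      · refine Or.inr ⟨by rwa [← e], fun i => ?_, Or.inl (by rwa [← e])⟩
        by_cases hk : i = k
        · subst hk; rw [← e0]; exact s2 0
        by_cases hm : i = m
        · subst hm; rw [← e1]; exact s2 1
        · exact Or.inr (hother i hk hm)
    · exact ih (by omega) hF

end CompleteSet

/-! ### Top horizontal faces -/

section TopFace

variable {n : ℕ} {D : Diagram (n + 1)}

theorem HAdj.symm {α β : Fin n → ℤ} (h : HAdj α β) : HAdj β α := by
  obtain ⟨i, j, hij, h⟩ := h
  exact ⟨j, i, hij.symm, h.symm⟩

/-- The connected component of a point in the set of points satisfying `Q` is a maximal connected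
set of such points. -/
theorem maximal_component (Q : (Fin n → ℤ) → Prop) {x : Fin n → ℤ} (hx : Q x) :
    ∃ S : Set (Fin n → ℤ), x ∈ S ∧
      Maximal (fun S' : Set (Fin n → ℤ) => (∀ α ∈ S', Q α) ∧ Conn HAdj S') S := by
  set R : (Fin n → ℤ) → (Fin n → ℤ) → Prop := fun y z => Q y ∧ Q z ∧ HAdj y z with hR
  set S : Set (Fin n → ℤ) := {y | Relation.ReflTransGen R x y} with hS
  have hpath : ∀ y, Relation.ReflTransGen R x y →
      Relation.ReflTransGen (fun a b => a ∈ S ∧ b ∈ S ∧ HAdj a b) x y := by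
    intro y hy
    induction hy with
    | refl => exact .refl
    | tail h1 h2 ih => exact ih.tail ⟨h1, h1.tail h2, h2.2.2⟩
  refine ⟨S, .refl, ⟨fun y hy => ?_, fun y hy z hz => ?_⟩, fun S' hS' hSS' y hy => ?_⟩
  · rcases Relation.ReflTransGen.cases_tail hy with rfl | ⟨z, -, hz⟩
    · exact hx
    · exact hz.2.1
  · refine Relation.ReflTransGen.trans ?_ (hpath z hz)
    exact (@Relation.ReflTransGen.stdSymm _ _ ⟨fun a b hab => ⟨hab.2.1, hab.1, hab.2.2.symm⟩⟩).symm
      _ _ (hpath y hy)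
  · have h := hS'.2 x (hSS' .refl) y hy
    exact h.lift id fun a b hab => ⟨hS'.1 a hab.1, hS'.1 b hab.2.1, hab.2.2⟩

/-- Just above the top degree there is a top corner, hence a horizontal face. -/
theorem OnlySourceZero.exists_isHorizontalFace (hD : D.OnlySourceZero) {T : ℕ}
    (hT : D.IsTopDegree T) (hn : 4 ≤ n + 1) : ∃ S, IsHorizontalFace D (T + 1) S := by
  set i : Fin (n + 1) := ⟨0, by omega⟩ with hi
  obtain ⟨α, ⟨hα, hαT⟩, hmax⟩ := Set.exists_max_image {α | D α ≠ 0 ∧ degree α = T}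
    (fun α => α i) (hD.finite.subset fun α h => h.1) hT.exists_eq
  have hdown : ∀ j, D (down j (up i α)) ≠ 0 ↔ j = i := by
    intro j
    constructor
    · intro h
      by_contra hj
      have := hmax (down j (up i α)) ⟨h, by rw [degree_down, degree_up, hαT]; ring⟩
      simp only [down_of_ne (Ne.symm hj), up_self] at this
      omega
    · rintro rfl
      rwa [down_up]
  have hzero : D (up i α) = 0 := by
    by_contra hc
    have := hT.le _ hc
    rw [degree_up, hαT] at this
    omega
  have htop : IsTopCorner D (up i α) := by
    refine ⟨hzero, ?_⟩
    simp [numDown, hdown, Finset.filter_eq']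
  obtain ⟨S, hS1, hS2⟩ := maximal_component (fun β => (IsTopCorner D β ∨ IsBottomCorner D β ∨
      OnHorizontalEdge D β ∨ InHorizontalFace D β) ∧ degree β = (T : ℤ) + 1 ∧
      ∀ h, h ≠ i → h ≠ ⟨1, by omega⟩ → h ≠ ⟨2, by omega⟩ → β h = up i α h) (x := up i α)
    ⟨Or.inl htop, by rw [degree_up, hαT], fun _ _ _ _ => rfl⟩
  exact ⟨S, ⟨_, hS1⟩, i, ⟨1, by omega⟩, ⟨2, by omega⟩, up i α, by simp [hi],
    by simp [hi, Fin.ext_iff], by simp [Fin.ext_iff], hS2⟩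

/-- Suppose that no view does better than the bound. Then the nodes in degree `T + 1` are obtained
from points `τ` of degree `T` by increasing one coordinate `k`, at most one for each `k`, with
`τ_k + τ_m` as large as possible for all `m`.  In a plane in which only three coordinates vary,
this leaves room for three nodes. -/
theorem OnlySourceZero.exists_lt_of_topFace (hD : D.OnlySourceZero) {T : ℕ}
    (hT : D.IsTopDegree T) (hn : 4 ≤ n + 1) {S : Set (Fin (n + 1) → ℤ)}
    (hS : D.IsTopHorizontalFace S) (hcard : 3 < (S ∩ D.nodes).ncard) :
    ∃ k m, k ≠ m ∧ (view D k m).numNodes + (T + 1) < D.numNodes := by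
  by_contra hcon
  have hlow : ∀ k m σ β, k ≠ m → IsNode D σ → D (down k σ) ≠ 0 → D β ≠ 0 →
      degree β = degree σ - 1 → otherDegree k m σ ≤ otherDegree k m β := by
    intro k m σ β hkm hσ hk hβ hβσ
    by_contra! hlt
    exact hcon (hD.exists_lt_of_lower hT hn hkm hσ hk hβ hβσ hlt)
  obtain ⟨t, hface, htop⟩ := hS
  obtain ⟨S₀, hS₀⟩ := hD.exists_isHorizontalFace hT hn
  have htT := htop _ _ hS₀
  obtain ⟨-, i, j, l, c, hij, hil, hjl, hmax⟩ := hface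
  have hprop : ∀ σ ∈ S ∩ D.nodes, IsNode D σ ∧ degree σ = T + 1 ∧
      (∀ h, h ≠ i → h ≠ j → h ≠ l → σ h = c h) ∧ ∃ k, D (down k σ) ≠ 0 := by
    rintro σ ⟨hσS, hσ⟩
    obtain ⟨-, hdeg, hc⟩ := hmax.prop.1 σ hσS
    rcases (show IsNode D σ from hσ).active with h0 | ⟨k, hk⟩
    · have := hT.le _ h0
      omega
    · have := hT.le _ hk
      rw [degree_down] at this
      exact ⟨hσ, by omega, hc, k, hk⟩
  have hfin : (S ∩ D.nodes).Finite := hD.finite_nodes.subset Set.inter_subset_right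
  choose! κ hκ using fun σ hσ => (hprop σ hσ).2.2.2
  have hcmp : ∀ σ ∈ S ∩ D.nodes, ∀ τ ∈ S ∩ D.nodes, ∀ m, κ σ ≠ m →
      otherDegree (κ σ) m σ ≤ otherDegree (κ σ) m (down (κ τ) τ) := by
    intro σ hσ τ hτ m hm
    refine hlow _ _ _ _ hm (hprop σ hσ).1 (hκ σ hσ) (hκ τ hτ) ?_
    rw [degree_down, (hprop σ hσ).2.1, (hprop τ hτ).2.1]
  have hinj : Set.InjOn κ (S ∩ D.nodes) := by
    intro σ hσ τ hτ hκe
    have hdσ := (hprop σ hσ).2.1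
    have hdτ := (hprop τ hτ).2.1
    have hsum : ∀ m, m ≠ κ σ → τ m - σ m = -(τ (κ σ) - σ (κ σ)) := by
      intro m hm
      have h1 := hcmp σ hσ τ hτ m hm.symm
      have h2 := hcmp τ hτ σ hσ m (hκe ▸ hm.symm)
      rw [← hκe] at h1 h2
      rw [otherDegree_eq hm.symm, otherDegree_eq hm.symm, degree_down, down_self,
        down_of_ne hm] at h1 h2
      omega
    have hdiff : ∑ m, (τ m - σ m) = 0 := by
      rw [Finset.sum_sub_distrib]
      change degree τ - degree σ = 0
      omega
    rw [← Finset.add_sum_erase _ _ (Finset.mem_univ (κ σ)),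
      Finset.sum_congr rfl fun m hm => hsum m (Finset.ne_of_mem_erase hm), Finset.sum_const,
      Finset.card_erase_of_mem (Finset.mem_univ _), Finset.card_univ, Fintype.card_fin,
      Nat.add_sub_cancel, nsmul_eq_mul] at hdiff
    have h0 : τ (κ σ) - σ (κ σ) = 0 := by
      have h1 : (τ (κ σ) - σ (κ σ)) * (1 - (n : ℤ)) = 0 := by linarith
      rcases mul_eq_zero.1 h1 with h | h
      · exact h
      · omega
    funext m
    by_cases hm : m = κ σ
    · rw [hm]; omega
    · have := hsum m hm
      omega
  obtain ⟨σ, hσ, hσκ⟩ : ∃ σ ∈ S ∩ D.nodes, κ σ ∉ ({i, j, l} : Finset (Fin (n + 1))) := by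
    by_contra! hc
    have h1 : (κ '' (S ∩ D.nodes)).ncard ≤
        (({i, j, l} : Finset (Fin (n + 1))) : Set (Fin (n + 1))).ncard :=
      Set.ncard_le_ncard (by rintro _ ⟨σ, hσ, rfl⟩; exact hc σ hσ)
    rw [hinj.ncard_image, Set.ncard_coe_finset] at h1
    have := Finset.card_le_three (a := i) (b := j) (c := l)
    omega
  simp only [Finset.mem_insert, Finset.mem_singleton, not_or] at hσκ
  obtain ⟨hki, hkj, hkl⟩ := hσκ
  obtain ⟨τ, hτ, hτσ⟩ := Set.exists_ne_of_one_lt_ncard (by omega : 1 < (S ∩ D.nodes).ncard) σ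
  have hκne : κ τ ≠ κ σ := fun h => hτσ (hinj hτ hσ h)
  -- `σ` and `τ` agree in the coordinate `κ σ`, so all other coordinates of `σ` exceed those of
  -- the point below `τ`, although the degrees differ by one only
  have hcoord : ∀ m, κ σ ≠ m → down (κ τ) τ m + 1 ≤ σ m := by
    intro m hm
    have h1 := hcmp σ hσ τ hτ m hm
    rw [otherDegree_eq hm, otherDegree_eq hm, degree_down, down_of_ne hκne.symm,
      (hprop σ hσ).2.1, (hprop τ hτ).2.1, (hprop σ hσ).2.2.1 _ hki hkj hkl,
      (hprop τ hτ).2.2.1 _ hki hkj hkl] at h1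
    omega
  have hother : otherDegree i j (down (κ τ) τ) ≤ otherDegree i j σ := by
    refine Finset.sum_le_sum fun m _ => ?_
    by_cases hm : κ σ = m
    · rw [← hm, down_of_ne hκne.symm, (hprop σ hσ).2.2.1 _ hki hkj hkl,
        (hprop τ hτ).2.2.1 _ hki hkj hkl]
    · have := hcoord m hm
      omega
  rw [otherDegree_eq hij, otherDegree_eq hij, degree_down, (hprop σ hσ).2.1,
    (hprop τ hτ).2.1] at hother
  have h1 := hcoord i hki
  have h2 := hcoord j hkj
  omega

end TopFace

/-! ### Newton diagrams and their size -/

theorem IsNewton.onlySourceZero {n : ℕ} {D : Diagram n} (hD : D.IsNewton)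
    (hsource : ∀ α, D.IsSource α ↔ α = 0) : D.OnlySourceZero := by
  obtain ⟨-, q, -, rfl⟩ := hD
  have hpos : ∀ α, ofPoly q α ≠ 0 → (∀ i, 0 ≤ α i) ∧
      q.coeff (Finsupp.equivFunOnFinite.symm fun i => (α i).toNat) ≠ 0 := by
    intro α h
    unfold ofPoly at h
    split_ifs at h with h0
    · exact ⟨h0, by rwa [sign_ne_zero] at h⟩
    · exact absurd rfl h
  refine ⟨?_, fun α h => (hpos α h).1, hsource⟩
  refine (q.support.finite_toSet.image fun (s : Fin n →₀ ℕ) i => (s i : ℤ)).subset ?_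
  intro α hα
  obtain ⟨h0, hc⟩ := hpos α hα
  refine ⟨_, MvPolynomial.mem_support_iff.2 hc, ?_⟩
  funext i
  simpa using h0 i

/-- The size of `D` is in fact equal to `T + 1`, but only this inequality matters. -/
theorem HasSize.le {n : ℕ} {D : Diagram (n + 1)} (hD : D.OnlySourceZero) {T : ℕ}
    (hT : D.IsTopDegree T) {d : ℕ} (hd : D.HasSize d) : d ≤ T + 1 := by
  obtain ⟨a, s, ⟨⟨-, hsub⟩, hmin⟩, hds⟩ := hd
  have hbox : box a s ⊆ box 0 T :=
    hmin ⟨⟨0, T, rfl⟩, fun α hα => ⟨hD.nonneg α hα, hT.le α hα⟩⟩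
  have h0 : (0 : Fin (n + 1) → ℤ) ∈ box a s :=
    hsub (show D 0 ≠ 0 by rw [hD.apply_zero]; decide)
  have ha : degree a ≤ 0 := Finset.sum_nonpos fun i _ => h0.1 i
  have has : a ∈ box a s := ⟨fun _ => le_rfl, by omega⟩
  have ha0 : a = 0 := le_antisymm h0.1 (hbox has).1
  subst ha0
  have hcorner : Function.update (0 : Fin (n + 1) → ℤ) 0 (s : ℤ) ∈ box (0 : Fin (n + 1) → ℤ) s := by
    refine ⟨fun j => ?_, by rw [degree_update, degree_zero]; simp⟩
    by_cases hj : j = 0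
    · subst hj; simp
    · simp [hj]
  have := (hbox hcorner).2
  rw [degree_update, degree_zero] at this
  rw [degree_zero] at hds
  simp at this
  omega

end Diagram

theorem lemma5p1 {n : ℕ} (hn : 4 ≤ n + 1) (D : Diagram (n + 1)) (hD : D.IsNewton)
    (d : ℕ) (hd : D.HasSize d) (hsource : ∀ α, D.IsSource α ↔ α = 0) :
    (∃ k m : Fin (n + 1), k ≠ m ∧
      ((D.view k m).numNodes : ℤ) ≤ (D.numNodes : ℤ) - (d : ℤ)) ∧
    (((∃ k m : Fin (n + 1), k ≠ m ∧ ∃ 𝓕 : List (Diagram 2), D.IsCompleteSet k m 𝓕 ∧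
          ∃ F ∈ 𝓕, ∃ v, F.IsFacialNode v) ∨
        (∃ S : Set (Fin (n + 1) → ℤ), D.IsTopHorizontalFace S ∧ 3 < (S ∩ D.nodes).ncard)) →
      ∃ k m : Fin (n + 1), k ≠ m ∧
        ((D.view k m).numNodes : ℤ) < (D.numNodes : ℤ) - (d : ℤ)) := by
  have hO := hD.onlySourceZero hsource
  obtain ⟨T, hT⟩ := hO.exists_isTopDegree
  have hdT := hd.le hO hT
  refine ⟨?_, fun h => ?_⟩
  · obtain ⟨k, m, hkm, h⟩ := hO.exists_le hT hn
    exact ⟨k, m, hkm, by omega⟩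
  · suffices h : ∃ k m, k ≠ m ∧ (D.view k m).numNodes + (T + 1) < D.numNodes by
      obtain ⟨k, m, hkm, h⟩ := h
      exact ⟨k, m, hkm, by omega⟩
    rcases h with ⟨k, m, hkm, 𝓕, h𝓕, F, hF, v, hv⟩ | ⟨S, hS, hcard⟩
    · obtain ⟨σ, hσ, hk, hm⟩ := Diagram.IsCompleteFrom.exists_node hO hkm h𝓕 le_rfl hF hv
      exact hO.exists_lt_of_two_down hT hn hσ hkm hk hm
    · exact hO.exists_lt_of_topFace hT hn hS hcard
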